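/- **Conventions.** Logarithms are to base $2$ and $U_k$ is the uniform distribution on $\{0,1\}^k$. The min-entropy of a distribution $X$ on $\{0,1\}^a$ is $\min\{\log(1/\Pr[X=s]) : \Pr[X=s]\neq 0\}$. The statistical distance of two distributions $P,Q$ on $\{0,1\}^m$ is $\max_{A\subseteq\{0,1\}^m}|\Pr[P\in A]-\Pr[Q\in A]|$. For real $k$, a function $E:\{0,1\}^a\times\{0,1\}^d\to\{0,1\}^m$ is a $(k,\epsilon)$-extractor if for every distribution $X$ on $\{0,1\}^a$ with min-entropy at least $k$, the distribution $E(X,U_d)$ (with $U_d$ independent of $X$) has statistical distance at most $\epsilon$ from $U_m$. **Construction.** Let $n\ge 1$, $N=2^n$, $\overline N=nN$, and identify $\{0,1\}^n$ with $[N]=\{1,\dots,N\}$ in lexicographic order. A string $X\in\{0,1\}^{\overline N}$ is viewed as the truth-table of a function $X:[N]\to[N]$. Starting from the identity permutation $P$ of $[N-1]$, for $i=1,\dots,N-1$ in this order, swap the entries $P(i)$ and $P(Y(i))$, where $Y(i)=1+(X(i)\bmod i)$. Let $R_X$ be the circular permutation ($N$-cycle) of $\{0,1\}^n\cong[N]$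 with $(R_X(1),R_X^2(1),\dots,R_X^{N-1}(1))=(P(1)+1,\dots,P(N-1)+1)$, and let $\overline R_X$ be its $\ell$-fold direct product, $\overline R_X(x_1\odot\cdots\odot x_\ell)=R_X(x_1)\odot\cdots\odot R_X(x_\ell)$, a permutation of $\{0,1\}^{\ell n}$ ($\odot$ is concatenation). For $(\overline x,r)\in\{0,1\}^{\ell n}\times\{0,1\}^{\ell n}$ put $$E(X,(\overline x,r))=b_0\odot b_1\odot\cdots\odot b_{m-1},\qquad b_i=r\cdot\overline R_X^{\,i}(\overline x),$$ where $\cdot$ is the inner product modulo $2$. Thus $E:\{0,1\}^{\overline N}\times\{0,1\}^{2\ell n}\to\{0,1\}^m$. **Theorem.** Let $\lambda\in(0,1)$, $\alpha>0$ and $\beta>0$ be constants with $\alpha<\lambda/3$ and $\beta<(\lambda-3\alpha)/4$, and let $\delta=(\lambda-4\beta-3\alpha)/4$. There are $C$ and $n_0$, depending only on $\lambda,\alpha,\beta$, such that for all $n\ge n_0$, all natural numbers $m\le N^\alpha$ and all real $\epsilon\ge N^{-\beta}$, with $$\ell=\Big\lceil \frac3\delta\,\log\frac{2m}{\epsilon}\Big\rceil$$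 (read as $0$ if $m=0$ or the right-hand side is negative), the function $E$ is a $(\lambda\overline N,2\epsilon)$-extractor; moreover $\ell\le C\,n$ and the seed length satisfies $2\ell n\le C\log^2\overline N$. -/

import Mathlib

namespace CryptoExtractor

noncomputable section

/-- Binary strings of length `k`, with bits in the field with two elements. -/
abbrev Str (k : ℕ) : Type := Fin k → ZMod 2

/-! ### Min-entropy, statistical distance, extractors -/

/-- The min-entropy `min {log₂ (1 / Prob(X = a)) | Prob(X = a) ≠ 0}` of a distribution on
`{0,1}^k` (a minimum over a finite non-empty set). -/
def minEntropy {k : ℕ} (X : PMF (Str k)) : ℝ :=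
  ⨅ a : X.support, Real.logb 2 (1 / (X a).toReal)

/-- The probability that a sample from `P` falls in `A`. -/
def prob {k : ℕ} (P : PMF (Str k)) (A : Set (Str k)) : ℝ :=
  (P.toOuterMeasure A).toReal

/-- The statistical distance `max_A |Prob(P ∈ A) - Prob(Q ∈ A)|` (a maximum over the finitely
many subsets `A` of `{0,1}^k`). -/
def statDist {k : ℕ} (P Q : PMF (Str k)) : ℝ :=
  ⨆ A : Set (Str k), |prob P A - prob Q A|

/-- The distribution of `E(x, y)` where `x` is drawn from `X` and, independently, `y` is drawn
uniformly from `{0,1}^d`. -/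
def outputDist {a d m : ℕ} (E : Str a → Str d → Str m) (X : PMF (Str a)) : PMF (Str m) :=
  X.bind fun x => (PMF.uniformOfFintype (Str d)).map (E x)

/-- `E : {0,1}^a × {0,1}^d → {0,1}^m` is a `(k, ε)`-extractor. -/
def IsExtractor {a d m : ℕ} (k ε : ℝ) (E : Str a → Str d → Str m) : Prop :=
  ∀ X : PMF (Str a), k ≤ minEntropy X →
    statDist (outputDist E X) (PMF.uniformOfFintype (Str m)) ≤ ε

/-! ### Strings as concatenations of blocks, and as numbers -/

/-- A string of length `a * b` is the concatenation of `a` blocks of length `b`; this is the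
block number `i` (counting from `0`), consisting of the bits `b * i, …, b * i + b - 1`. -/
def block {a b : ℕ} (s : Str (a * b)) (i : Fin a) : Str b :=
  fun j => s (finProdFinEquiv (i, j))

/-- The concatenation of `a` blocks of length `b`. -/
def concat {a b : ℕ} (f : Fin a → Str b) : Str (a * b) :=
  fun k => f (finProdFinEquiv.symm k).1 (finProdFinEquiv.symm k).2

/-- The rank (counting from `0`) of a string of length `n` in the lexicographic order, that is,
the number whose binary expansion is the string, most significant bit first. The string `s` is
identified with the element `rank n s + 1` of `[N] = {1, …, N}`, where `N = 2 ^ n`. -/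
def rank (n : ℕ) : Str n ≃ Fin (2 ^ n) :=
  (Equiv.arrowCongr Fin.revPerm (Equiv.refl (Fin 2) : ZMod 2 ≃ Fin 2)).trans finFunctionFinEquiv

theorem rank_val (n : ℕ) (s : Str n) :
    (rank n s : ℕ) = ∑ i : Fin n, (s i).val * 2 ^ (n - 1 - (i : ℕ)) := by
  have h : (rank n s : ℕ) = ∑ i : Fin n, (s (Fin.revPerm i)).val * 2 ^ (i : ℕ) :=
    finFunctionFinEquiv_apply (m := 2) _
  rw [h, ← Equiv.sum_comp Fin.revPerm]
  refine Finset.sum_congr rfl fun i _ => ?_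
  have e : n - 1 - (i : ℕ) = ((Fin.revPerm i : Fin n) : ℕ) := by
    simp only [Fin.revPerm_apply, Fin.val_rev]; omega
  rw [e]; simp

/-! ### The swap procedure -/

/-- The function `X : [N] → [N]` whose truth-table is the string `X`. The argument `i`, counted
from `0`, stands for the element `i + 1` of `[N]`; the value is in `{1, …, N}`. -/
def tableValue {n : ℕ} (X : Str (2 ^ n * n)) (i : Fin (2 ^ n)) : ℕ :=
  (rank n (block X i) : ℕ) + 1

/-- The value `Y(i) = 1 + (X(i) mod i)`, for `i ∈ [N - 1]`. Both `i` and `Y(i)` are elements of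
`{1, …, N - 1}`, represented with counting from `0`: the argument `i` stands for `i + 1` and the
result `X(i + 1) mod (i + 1)` stands for `1 + (X(i + 1) mod (i + 1))`. -/
def swapIndex {n : ℕ} (X : Str (2 ^ n * n)) (i : Fin (2 ^ n - 1)) : Fin (2 ^ n - 1) :=
  ⟨tableValue X (i.castLE (Nat.sub_le _ _)) % (i.val + 1),
    (Nat.lt_succ_iff.mp (Nat.mod_lt _ (Nat.succ_pos _))).trans_lt i.isLt⟩

/-- The permutation of `[N - 1]` obtained from the identity by swapping, for `i = 1, …, N - 1`
in this order, the entries `R(i)` and `R(Y(i))`. -/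
def swapPerm {n : ℕ} (X : Str (2 ^ n * n)) : Equiv.Perm (Fin (2 ^ n - 1)) :=
  (List.finRange (2 ^ n - 1)).foldl (fun R i => R * Equiv.swap i (swapIndex X i)) 1

/-- The sequence `(1, P(1) + 1, P(2) + 1, …, P(N - 1) + 1)` for a permutation `P` of `[N - 1]`,
as a permutation of `[N]` (all counted from `0`). -/
def cycleOrder (n : ℕ) (P : Equiv.Perm (Fin (2 ^ n - 1))) : Equiv.Perm (Fin (2 ^ n)) :=
  (finCongr (Nat.sub_add_cancel Nat.one_le_two_pow)).permCongr
    (Equiv.Perm.decomposeFin.symm (0, P))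

/-- The circular permutation `R` of `{0,1}^n` determined by the string `X`: with `P` the output
of the swap procedure, `R` is the `N`-cycle with
`(R(1), R²(1), …, R^{N-1}(1)) = (P(1) + 1, P(2) + 1, …, P(N - 1) + 1)`.
In other words `R` maps each entry of the sequence `cycleOrder n P` to the next one,
cyclically. -/
def circPerm {n : ℕ} (X : Str (2 ^ n * n)) : Equiv.Perm (Str n) :=
  (rank n).symm.permCongr
    ((cycleOrder n (swapPerm X)).permCongr (finRotate (2 ^ n)))

/-! ### The extractor -/

/-- The `ℓ`-fold direct product
`R̄(x₁ ⊙ ⋯ ⊙ x_ℓ) = R(x₁) ⊙ ⋯ ⊙ R(x_ℓ)`. -/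
def directProduct {n : ℕ} (ℓ : ℕ) (R : Str n → Str n) (x : Str (ℓ * n)) : Str (ℓ * n) :=
  concat fun i => R (block x i)

/-- The extractor `E : {0,1}^{N n} × {0,1}^{2 ℓ n} → {0,1}^m`. The seed is `x̄ ⊙ r` with
`x̄` and `r` of length `ℓ n`; the output bits are the inner products modulo `2`
`b_i = r · R̄^i(x̄)`, for `0 ≤ i < m`. -/
def extractor (n ℓ m : ℕ) (X : Str (2 ^ n * n)) (seed : Str (2 * (ℓ * n))) : Str m :=
  fun i => dotProduct (block seed 1) ((directProduct ℓ (circPerm X))^[(i : ℕ)] (block seed 0))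

/-- The number of factors `ℓ = ⌈(3 / δ) log₂ (2 m (1 / ε))⌉` with
`δ = (lam - 4 β - 3 α) / 4`. -/
def numFactors (lam α β : ℝ) (m : ℕ) (ε : ℝ) : ℕ :=
  ⌈(3 / ((lam - 4 * β - 3 * α) / 4)) * Real.logb 2 (2 * m * (1 / ε))⌉₊

end

end CryptoExtractor

/-! The proof is a compression argument: for each test `A`, the inputs `X` on which the output
distribution fails `A` by more than `ε` have short descriptions, so there are at most `ε * 2 ^ (lam
* n * N)` of them, where `N = 2 ^ n`. A source of min-entropy `lam * n * N` hits them with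
probability at most `ε`, and all other inputs err by at most `ε`; hence `2 * ε`
(`isExtractor_of_card_le`).

Fix a failing `X` with `R = circPerm X` and put `η = ε / m`. A hybrid argument turns the test into a
predictor of one output bit from the later bits (`exists_predict`). With `y = R̄^(i+1)(x̄)`, bit `i`
is `r · R̄⁻¹(y)` and the later bits depend only on `r` and the forward orbit of `y`. Parseval bounds
the number of linear functions of `r` that agree well with the predictor (`card_agreeing_le`), so
for a fraction `η` of the tuples `y` the preimage `R̄⁻¹(y)` lies in a list of about `1 / η ^ 2`
candidates determined by the orbit (`exists_dense_of_distinguish`).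

By the direct product lemma (`card_le_hardPoints`), outside about `δ * N` points every single `y`
can be placed in one of `T` fixed tuples so that the result is in this dense set. The orbits of
these tuples, the exceptional points with their preimages, and a list index per point then determine
`R`, recovered by walking backward along its cycle (`card_invertible_le`). Finally `R` determines
`X` up to `2 ^ n * 4 ^ N` possibilities (`card_le_card_circPerm`), and the exponents add up because
`lam = 4 * δ + 4 * β + 3 * α`. -/

namespace CryptoExtractor

open Finset Filter Topology

/-! ### Hitting sets and the direct product lemma -/

section Covering

variable {V Ω ι : Type*} [Fintype V] [Fintype Ω] [Fintype ι] [DecidableEq ι]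

open Classical in
/-- If each `C y`, `y ∈ G`, has density at least `τ`, then `T` points suffice to hit them all. -/
theorem exists_hitting [Nonempty Ω] (G : Finset V) (C : V → Finset Ω) (τ : ℝ) (hτ : τ ≤ 1) (T : ℕ)
    (hC : ∀ y ∈ G, τ * Fintype.card Ω ≤ #(C y))
    (hT : Fintype.card V * (1 - τ) ^ T < 1) :
    ∃ t : Fin T → Ω, ∀ y ∈ G, ∃ s, t s ∈ C y := by
  by_contra! hcon
  -- Union bound: a `t` that fails misses some `C y` in all `T` entries, and such `t` are too few to
  -- be everything.
  have hcov : (univ : Finset (Fin T → Ω)) ⊆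
      G.biUnion fun y => Fintype.piFinset fun _ : Fin T => (C y)ᶜ := by
    intro t _
    obtain ⟨y, hy, ht⟩ := hcon t
    simp only [mem_biUnion, Fintype.mem_piFinset, mem_compl]
    exact ⟨y, hy, ht⟩
  have h1 := (card_le_card hcov).trans card_biUnion_le
  have hΩ : (0 : ℝ) < Fintype.card Ω := by exact_mod_cast Fintype.card_pos
  have h2 : ((Fintype.card Ω : ℝ)) ^ T ≤
      ∑ y ∈ G, ((1 - τ) * Fintype.card Ω) ^ T := by
    have : ((Fintype.card Ω : ℝ)) ^ T ≤ ∑ y ∈ G, ((#((C y)ᶜ) : ℕ) : ℝ) ^ T := by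
      simp only [card_univ, Fintype.card_pi, prod_const, Fintype.card_fin,
        Fintype.card_piFinset] at h1
      exact_mod_cast h1
    refine this.trans (sum_le_sum fun y hy => ?_)
    refine pow_le_pow_left₀ (by positivity) ?_ _
    have h3 : (#((C y)ᶜ) : ℝ) = Fintype.card Ω - #(C y) := by
      rw [card_compl, Nat.cast_sub (card_le_univ _)]
    rw [h3]; linarith [hC y hy]
  rw [sum_const, nsmul_eq_mul, mul_pow, ← mul_assoc] at h2
  have h4 : (#G : ℝ) * (1 - τ) ^ T < 1 := by
    refine lt_of_le_of_lt ?_ hT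
    have := pow_nonneg (sub_nonneg.mpr hτ) T
    gcongr
    exact card_le_univ G
  have h5 := mul_lt_mul_of_pos_right h4 (pow_pos hΩ T)
  linarith

open Classical in
/-- The points that lie in few members of `S`, whatever coordinate they are put in. -/
noncomputable def hardPoints (S : Finset (ι → V)) (c : ℝ) : Finset V :=
  {y | ∀ j, (#{t : ι → V | Function.update t j y ∈ S} : ℝ) < c}

-- Double counting: exchanging coordinate `j` of the tuple with a free point is a bijection between
-- the two sides.
open Classical in
theorem card_mul_card_filter_mem (S : Finset (ι → V)) (H : Finset V) (j : ι) :
    Fintype.card V * #{t ∈ S | t j ∈ H} = ∑ y ∈ H, #{t : ι → V | Function.update t j y ∈ S} := by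
  rw [← card_sigma, ← card_univ, mul_comm, ← card_product]
  refine card_nbij' (fun q => ⟨q.1 j, Function.update q.1 j q.2⟩)
    (fun q => (Function.update q.2 j q.1, q.2 j)) ?_ ?_ ?_ ?_
  · rintro ⟨t, y⟩ h
    simp_all
  · rintro ⟨y, t⟩ h
    simp_all
  · rintro ⟨t, y⟩ h
    simp
  · rintro ⟨y, t⟩ h
    simp

/-- Direct product lemma: a set of tuples that is dense is dense above most points. -/
theorem card_le_hardPoints [Nonempty V] (S : Finset (ι → V)) (c : ℝ) (hc : 0 ≤ c) :
    (#S : ℝ) ≤ ((Fintype.card V : ℝ) - #(hardPoints S c)) ^ Fintype.card ι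
      + Fintype.card ι * c := by
  classical
  set H := hardPoints S c with hH
  -- A member of `S` either avoids `H` altogether, which gives the power, or has a coordinate in
  -- `H`; the latter tuples number at most `c` for each coordinate.
  have hsub : S ⊆ (Fintype.piFinset fun _ : ι => Hᶜ) ∪
      univ.biUnion fun j => {t ∈ S | t j ∈ H} := by
    intro t ht
    by_cases h : ∀ j, t j ∉ H
    · exact mem_union_left _ (by simpa [Fintype.mem_piFinset] using h)
    · push Not at h
      refine mem_union_right _ ?_
      simpa [ht] using h
  have h1 := (card_le_card hsub).trans
    ((card_union_le _ _).trans (Nat.add_le_add_left card_biUnion_le _))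
  have hV : (0 : ℝ) < Fintype.card V := by exact_mod_cast Fintype.card_pos
  have h2 : ∀ j, (#{t ∈ S | t j ∈ H} : ℝ) ≤ c := by
    intro j
    have e := card_mul_card_filter_mem S H j
    have e' : (Fintype.card V : ℝ) * #{t ∈ S | t j ∈ H} ≤ Fintype.card V * c := by
      calc (Fintype.card V : ℝ) * #{t ∈ S | t j ∈ H}
          = ∑ y ∈ H, (#{t : ι → V | Function.update t j y ∈ S} : ℝ) := by exact_mod_cast e
        _ ≤ ∑ y ∈ H, c := by
            refine sum_le_sum fun y hy => ?_
            have := (mem_filter.mp hy).2 j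
            convert this.le
        _ = #H * c := by rw [sum_const, nsmul_eq_mul]
        _ ≤ Fintype.card V * c := by
            gcongr
            exact card_le_univ H
    exact le_of_mul_le_mul_left e' hV
  calc (#S : ℝ) ≤ #(Fintype.piFinset fun _ : ι => Hᶜ) + ∑ j, (#{t ∈ S | t j ∈ H} : ℝ) := by
        exact_mod_cast h1
    _ ≤ _ := by
        refine add_le_add (le_of_eq ?_) ?_
        · rw [Fintype.card_piFinset, prod_const, card_univ, card_compl]
          push_cast [Nat.cast_sub (card_le_univ H)]
          rfl
        · refine (sum_le_sum fun j _ => h2 j).trans ?_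
          simp

/-- All points outside a small set extend, in some coordinate, one of `T` tuples to a member
of `S`. -/
theorem exists_tuples [Nonempty V] [Nonempty ι] (S : Finset (ι → V)) (τ : ℝ) (hτ0 : 0 ≤ τ) (hτ : τ ≤ 1)
    (T h : ℕ)
    (hS : ((Fintype.card V : ℝ) - h) ^ Fintype.card ι
      + Fintype.card ι * (τ * Fintype.card V ^ Fintype.card ι) < #S)
    (hT : Fintype.card V * (1 - τ) ^ T < 1) :
    ∃ (H : Finset V) (t : Fin T → ι → V), #H ≤ h ∧
      ∀ y ∉ H, ∃ s j, Function.update (t s) j y ∈ S := by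
  classical
  set c : ℝ := τ * Fintype.card V ^ Fintype.card ι with hc
  set H := hardPoints S c with hH
  have key : ∀ y ∈ Hᶜ, ∃ j, c ≤ #{t : ι → V | Function.update t j y ∈ S} := by
    intro y hy
    by_contra! hcon
    refine mem_compl.mp hy (mem_filter.mpr ⟨mem_univ _, fun j => ?_⟩)
    convert hcon j
  choose! f hf using key
  obtain ⟨t, ht⟩ := exists_hitting (Hᶜ) (fun y => {t : ι → V | Function.update t (f y) y ∈ S})
    τ hτ T (by simpa [hc] using hf) hT
  refine ⟨H, t, ?_, fun y hy => ?_⟩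
  · by_contra! hlt
    have h1 := card_le_hardPoints S c (by positivity)
    rw [← hH] at h1
    have h2 : ((Fintype.card V : ℝ) - #H) ^ Fintype.card ι
        ≤ ((Fintype.card V : ℝ) - h) ^ Fintype.card ι := by
      refine pow_le_pow_left₀ ?_ ?_ _
      · rw [sub_nonneg]; exact_mod_cast card_le_univ H
      · have : (h : ℝ) ≤ #H := by exact_mod_cast hlt.le
        linarith
    linarith
  · obtain ⟨s, hs⟩ := ht y (mem_compl.mpr hy)
    exact ⟨s, f y, (mem_filter.mp hs).2⟩

end Covering

theorem exists_subset_range {α : Type*} [Nonempty α] {L : ℕ} (F : Finset α) (hF : #F ≤ L) :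
    ∃ f : Fin L → α, ↑F ⊆ Set.range f := by
  rcases F.eq_empty_or_nonempty with rfl | hne
  · exact ⟨fun _ => Classical.arbitrary α, by simp⟩
  · have : Nonempty F := hne.to_subtype
    obtain ⟨g, hg⟩ : ∃ g : F → Fin L, Function.Injective g :=
      ⟨fun x => Fin.castLE hF (F.equivFin x), fun x y hxy => by simpa using hxy⟩
    refine ⟨fun i => (Function.invFun g i : F), fun y hy => ⟨g ⟨y, hy⟩, ?_⟩⟩
    simp [Function.leftInverse_invFun hg ⟨y, hy⟩]

/-! ### Encoding a cycle that can be inverted on a dense set of tuples -/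

section Compression

variable {V P : Type*}

/-- The first `m` points of the forward orbit of `y`. -/
def orbit (m : ℕ) (R : Equiv.Perm V) (y : V) : Fin m → V := fun k => (R ^ (k : ℕ)) y

/-- The orbit of `R⁻¹ y` is `R⁻¹ y` followed by the orbit of `y` without its last point. This is
what lets the decoder continue after one step backward. -/
theorem orbit_inv_apply {m : ℕ} {R R' : Equiv.Perm V} {y : V}
    (ho : orbit m R y = orbit m R' y) (hi : R⁻¹ y = R'⁻¹ y) :
    orbit m R (R⁻¹ y) = orbit m R' (R⁻¹ y) := by
  funext ⟨k, hk⟩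
  cases k with
  | zero => rfl
  | succ k =>
    have := congrFun ho ⟨k, by omega⟩
    simp only [orbit] at this ⊢
    conv_rhs => rw [hi]
    rw [pow_succ, pow_succ, Equiv.Perm.mul_apply, Equiv.Perm.mul_apply]
    simpa using this

variable [Fintype V] [Fintype P]

/-- `dec`, given the parameter `p` and the forward orbits of a tuple, lists candidates for the
preimage of the tuple; this is the set of tuples for which the list is correct. -/
noncomputable def invertible {ℓ m L : ℕ}
    (dec : P → (Fin ℓ → Fin m → V) → Fin L → Fin ℓ → V) (R : Equiv.Perm V) (p : P) :
    Finset (Fin ℓ → V) :=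
  open Classical in {y | ∃ i, dec p (fun a => orbit m R (y a)) i = fun a => R⁻¹ (y a)}

open Classical in
/-- Few cyclic permutations have direct products that can be inverted on a dense set. -/
theorem card_invertible_le [Nonempty P] {ℓ m L T h : ℕ} (hm : 0 < m)
    (hℓ : 0 < ℓ) (hL : 0 < L) (hT0 : 0 < T) (τ η : ℝ) (hτ0 : 0 ≤ τ) (hτ : τ ≤ 1)
    (y₀ : V) (dec : P → (Fin ℓ → Fin m → V) → Fin L → Fin ℓ → V)
    (B : Finset (Equiv.Perm V))
    (hcyc : ∀ R ∈ B, ∀ y, ∃ k : ℕ, (R⁻¹ ^ k) y₀ = y)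
    (hB : ∀ R ∈ B, ∃ p, η * Fintype.card V ^ ℓ ≤ #(invertible dec R p))
    (hη : ((Fintype.card V : ℝ) - h) ^ ℓ + ℓ * (τ * Fintype.card V ^ ℓ)
      < η * Fintype.card V ^ ℓ)
    (hT : Fintype.card V * (1 - τ) ^ T < 1) :
    #B ≤ Fintype.card P * (Fintype.card V ^ m * (((Fintype.card V ^ m) ^ ℓ) ^ T *
      (Fintype.card V ^ h * (Fintype.card V ^ h * (T * (ℓ * L)) ^ Fintype.card V)))) := by
  have : Nonempty V := ⟨y₀⟩
  have : Nonempty (Fin ℓ) := ⟨⟨0, hℓ⟩⟩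
  have : Nonempty (Fin T × Fin ℓ × Fin L) := ⟨⟨0, hT0⟩, ⟨0, hℓ⟩, ⟨0, hL⟩⟩
  have data : ∀ R ∈ B, ∃ (p : P) (t : Fin T → Fin ℓ → V) (e : Fin h → V)
      (c : V → Fin T × Fin ℓ × Fin L), ∀ y, y ∉ Set.range e →
      dec p (fun a => orbit m R (Function.update (t (c y).1) (c y).2.1 y a)) (c y).2.2 =
        fun a => R⁻¹ (Function.update (t (c y).1) (c y).2.1 y a) := by
    intro R hR
    obtain ⟨p, hp⟩ := hB R hR
    obtain ⟨H, t, hH, ht⟩ := exists_tuples (invertible dec R p) τ hτ0 hτ T h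
      (by simpa using hη.trans_le hp) hT
    obtain ⟨e, he⟩ := exists_subset_range H hH
    have key : ∀ y, ∃ q : Fin T × Fin ℓ × Fin L, y ∉ Set.range e →
        dec p (fun a => orbit m R (Function.update (t q.1) q.2.1 y a)) q.2.2 =
          fun a => R⁻¹ (Function.update (t q.1) q.2.1 y a) := by
      intro y
      by_cases hy : y ∈ Set.range e
      · exact ⟨Classical.arbitrary _, fun hn => absurd hy hn⟩
      · obtain ⟨s, j, hs⟩ := ht y fun hyH => hy (he hyH)
        obtain ⟨i, hi⟩ := (mem_filter.mp hs).2
        exact ⟨(s, j, i), fun _ => hi⟩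
    choose c hc using key
    exact ⟨p, t, e, c, hc⟩
  choose! p t e c hc using data
  -- The code of `R`: the parameter, the orbit of the starting point, the orbits of all entries of
  -- the `T` tuples, the exceptional points, their preimages, and for each point a tuple, a
  -- coordinate and a list index.
  let code : Equiv.Perm V → P × (Fin m → V) × (Fin T → Fin ℓ → Fin m → V) ×
      (Fin h → V) × (Fin h → V) × (V → Fin T × Fin ℓ × Fin L) := fun R =>
    (p R, orbit m R y₀, fun s a => orbit m R (t R s a), e R, fun i => R⁻¹ (e R i), c R)
  have hinj : Set.InjOn code B := by
    intro R hR R' hR' hcode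
    simp only [code, Prod.mk.injEq] at hcode
    obtain ⟨h1, h2, h3, h4, h5, h6⟩ := hcode
    -- Entry `0` of an orbit is the point itself (here `0 < m` matters), so the tuples need no code
    -- of their own.
    have ht : t R = t R' := by
      funext s a
      exact congrFun (congrFun (congrFun h3 s) a) ⟨0, hm⟩
    have step : ∀ y, orbit m R y = orbit m R' y → R⁻¹ y = R'⁻¹ y := by
      intro y hy
      by_cases hye : y ∈ Set.range (e R)
      · obtain ⟨i, rfl⟩ := hye
        have := congrFun h5 i
        rwa [← h4] at this
      · have e1 := hc R hR y hye
        have e2 := hc R' hR' y (h4 ▸ hye)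
        rw [← h1, ← h6, ← ht] at e2
        -- The decoder knows every orbit here: at the chosen coordinate it is that of `y`, elsewhere
        -- it is stored.
        have e3 : (fun a => orbit m R (Function.update (t R (c R y).1) (c R y).2.1 y a)) =
            fun a => orbit m R' (Function.update (t R (c R y).1) (c R y).2.1 y a) := by
          funext a
          by_cases ha : a = (c R y).2.1
          · subst ha; simpa using hy
          · simp only [Function.update_of_ne ha]
            have := congrFun (congrFun h3 (c R y).1) a
            rwa [← ht] at this
        rw [e3, e2] at e1
        simpa using (congrFun e1 (c R y).2.1).symm
    -- From `y₀` the decoder walks backward, always knowing the orbit of the current point; `hcyc`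
    -- says that the walk meets every point.
    have walk : ∀ k : ℕ, (R⁻¹ ^ k) y₀ = (R'⁻¹ ^ k) y₀ ∧
        orbit m R ((R⁻¹ ^ k) y₀) = orbit m R' ((R⁻¹ ^ k) y₀) := by
      intro k
      induction k with
      | zero => exact ⟨rfl, h2⟩
      | succ k ih =>
        have hs := step _ ih.2
        rw [pow_succ', pow_succ', Equiv.Perm.mul_apply, Equiv.Perm.mul_apply, ← ih.1]
        exact ⟨hs, orbit_inv_apply ih.2 hs⟩
    refine inv_injective (Equiv.ext fun y => ?_)
    obtain ⟨k, rfl⟩ := hcyc R hR y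
    exact step _ (walk k).2
  have := card_le_card_of_injOn code (fun _ _ => mem_univ _) hinj
  simpa using this

end Compression

/-! ### Characters, Parseval and the list size of the Hadamard code -/

section ListDecoding

/-- The character `(-1) ^ x` of the field with two elements. -/
noncomputable def sign (x : ZMod 2) : ℝ := if x = 0 then 1 else -1

theorem eq_zero_or_one (x : ZMod 2) : x = 0 ∨ x = 1 := by
  revert x; decide

theorem sign_add (x y : ZMod 2) : sign (x + y) = sign x * sign y := by
  rcases eq_zero_or_one x with rfl | rfl <;> rcases eq_zero_or_one y with rfl | rfl <;>
    simp [sign, CharTwo.add_self_eq_zero]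

theorem sign_mul_self (x : ZMod 2) : sign x * sign x = 1 := by
  unfold sign; split_ifs <;> norm_num

variable {ι : Type*} [Fintype ι] [DecidableEq ι]

/-- If `a i = 1`, translation by the `i`-th unit vector negates every term, so the sum is its own
negative. -/
theorem sum_sign_dotProduct (a : ι → ZMod 2) :
    ∑ z : ι → ZMod 2, sign (dotProduct a z) = if a = 0 then 2 ^ Fintype.card ι else 0 := by
  split_ifs with h
  · simp [h, sign]
  · obtain ⟨i, hi⟩ := Function.ne_iff.mp h
    have hi' : a i = 1 := Fin.eq_one_of_ne_zero _ hi
    have e := Equiv.sum_comp (Equiv.addRight (Pi.single i (1 : ZMod 2)))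
      fun z => sign (dotProduct a z)
    simp only [Equiv.coe_addRight, dotProduct_add, dotProduct_single, hi', mul_one,
      sign_add] at e
    rw [← sum_mul] at e
    have : sign 1 = -1 := by simp [sign]
    rw [this] at e
    linarith

/-- Parseval's identity. -/
theorem sum_sq_correlation (f : (ι → ZMod 2) → ZMod 2) :
    ∑ z : ι → ZMod 2, (∑ r, sign (f r) * sign (dotProduct r z)) ^ 2 =
      (2 ^ Fintype.card ι) ^ 2 := by
  have h1 : ∀ z : ι → ZMod 2, (∑ r, sign (f r) * sign (dotProduct r z)) ^ 2 =
      ∑ r, ∑ r', sign (f r) * sign (f r') * sign (dotProduct (r + r') z) := by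
    intro z
    rw [sq, sum_mul_sum]
    refine sum_congr rfl fun r _ => sum_congr rfl fun r' _ => ?_
    rw [add_dotProduct, sign_add]; ring
  simp_rw [h1]
  rw [sum_comm]
  have h2 : ∀ r : ι → ZMod 2, ∑ z : ι → ZMod 2,
      ∑ r', sign (f r) * sign (f r') * sign (dotProduct (r + r') z) = 2 ^ Fintype.card ι := by
    intro r
    rw [sum_comm]
    simp_rw [← mul_sum, sum_sign_dotProduct]
    rw [sum_eq_single r]
    · rw [if_pos (by ext i; exact CharTwo.add_self_eq_zero (r i)), sign_mul_self, one_mul]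
    · intro r' _ hr'
      rw [if_neg, mul_zero]
      intro h
      refine hr' (funext fun i => ?_)
      have := congrFun h i
      exact (CharTwo.add_eq_zero.mp this).symm
    · simp
  simp_rw [h2]
  simp [sq]

theorem sum_sign_mul_eq (f : (ι → ZMod 2) → ZMod 2) (z : ι → ZMod 2) :
    ∑ r, sign (f r) * sign (dotProduct r z) =
      2 * #{r | f r = dotProduct r z} - 2 ^ Fintype.card ι := by
  have h : ∀ r : ι → ZMod 2, sign (f r) * sign (dotProduct r z) =
      2 * (if f r = dotProduct r z then 1 else 0) - 1 := by
    intro r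
    generalize f r = x
    generalize dotProduct r z = y
    rcases eq_zero_or_one x with rfl | rfl <;> rcases eq_zero_or_one y with rfl | rfl <;>
      norm_num [sign]
  simp_rw [h, sum_sub_distrib, ← mul_sum, sum_boole]
  simp

/-- The linear functions having agreement at least `1 / 2 + η / 2` with `f`. -/
noncomputable def agreeing (η : ℝ) (f : (ι → ZMod 2) → ZMod 2) : Finset (ι → ZMod 2) :=
  {z | (1 / 2 + η / 2) * 2 ^ Fintype.card ι ≤ (#{r | f r = dotProduct r z} : ℝ)}

/-- Each member contributes at least `(η * M) ^ 2` to the Parseval sum, whose total is `M ^ 2`. -/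
theorem card_agreeing_le (η : ℝ) (hη : 0 < η) (f : (ι → ZMod 2) → ZMod 2) :
    (#(agreeing η f) : ℝ) ≤ 1 / η ^ 2 := by
  set M : ℝ := 2 ^ Fintype.card ι with hM
  have hM0 : 0 < M := by positivity
  have h1 : #(agreeing η f) * (η * M) ^ 2 ≤ M ^ 2 := by
    rw [← sum_sq_correlation f, ← nsmul_eq_mul, ← sum_const]
    refine (sum_le_sum fun z hz => ?_).trans
      (sum_le_sum_of_subset_of_nonneg (subset_univ _) fun z _ _ => sq_nonneg _)
    rw [sum_sign_mul_eq]
    refine pow_le_pow_left₀ (by positivity) ?_ _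
    have := (mem_filter.mp hz).2
    linarith
  rw [le_div_iff₀ (by positivity)]
  rw [mul_pow, ← mul_assoc] at h1
  exact le_of_mul_le_mul_right (by linarith) (pow_pos hM0 2)

end ListDecoding

/-! ### From distinguishing to predicting a bit from the later ones -/

section Hybrid

variable {m : ℕ} {Ω : Type*} [Fintype Ω]

/-- The string with the entries of `v` in front of position `i` and those of `b` from there. -/
def mix (i : ℕ) (v b : Str m) : Str m := fun j => if (j : ℕ) < i then v j else b j

open Classical in
/-- The prediction of bit `i` of `b` from the bits that follow. -/
noncomputable def predict (A : Set (Str m)) (i : Fin m) (v : Str m) (s : ZMod 2) (b : Str m) :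
    ZMod 2 :=
  v i + s + if mix (i + 1) v b ∈ A then 0 else 1

theorem predict_congr (A : Set (Str m)) (i : Fin m) (v : Str m) (s : ZMod 2) {b b' : Str m}
    (h : ∀ j, i < j → b j = b' j) : predict A i v s b = predict A i v s b' := by
  have : mix (i + 1) v b = mix (i + 1) v b' := by
    funext j
    unfold mix
    split_ifs with hj
    · rfl
    · exact h j (by rw [Fin.lt_def]; omega)
  unfold predict
  rw [this]

theorem mix_succ_of_eq {i : Fin m} {v b : Str m} (h : v i = b i) :
    mix (i + 1) v b = mix i v b := by
  funext j
  unfold mix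
  by_cases hj : j = i
  · subst hj; simp [h]
  · have : (j : ℕ) ≠ i := fun e => hj (Fin.ext e)
    by_cases hlt : (j : ℕ) < i
    · rw [if_pos hlt, if_pos (by omega)]
    · rw [if_neg hlt, if_neg (by omega)]

theorem mix_update (i : Fin m) (v b : Str m) (x : ZMod 2) :
    mix i (Function.update v i x) b = mix i v b := by
  funext j
  unfold mix
  split_ifs with hj
  · rw [Function.update_of_ne]; rintro rfl; omega
  · rfl

open Classical in
/-- The number of pairs `(v, ω)` for which the `i`-th hybrid falls in `A`. -/
noncomputable def hybrid (A : Set (Str m)) (b : Ω → Str m) (i : ℕ) : ℝ :=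
  ∑ ω, ∑ v, if mix i v (b ω) ∈ A then 1 else 0

/-- Negating bit `i`. -/
def flipBit (i : Fin m) : Equiv.Perm (Str m) :=
  Equiv.addRight (Pi.single i 1)

theorem flipBit_eq_update (i : Fin m) (v : Str m) :
    flipBit i v = Function.update v i (v i + 1) := by
  funext j
  by_cases h : j = i
  · subst h; simp [flipBit]
  · simp [flipBit, h]

/-- Exactly one of `v` and `flipBit i v` agrees with `b` at `i`. For that one the prediction is
right iff the hybrid is in `A`, and there the `i`-th and the next hybrid coincide; for the other it
is right iff the next hybrid is not in `A`. -/
theorem predict_pair (A : Set (Str m)) (i : Fin m) (v b : Str m) : 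
    open Classical in
    ((if predict A i v 0 b = b i then 1 else 0) +
      (if predict A i (flipBit i v) 0 b = b i then 1 else 0) : ℝ) =
    1 + 2 * (if mix i v b ∈ A then 1 else 0) - ((if mix (i + 1) v b ∈ A then 1 else 0)
      + (if mix (i + 1) (flipBit i v) b ∈ A then 1 else 0)) := by
  have main : ∀ v w : Str m, v i = b i → w = Function.update v i (v i + 1) →
      open Classical in
      ((if predict A i v 0 b = b i then 1 else 0) +
      (if predict A i w 0 b = b i then 1 else 0) : ℝ) =
      1 + 2 * (if mix i v b ∈ A then 1 else 0) - ((if mix (i + 1) v b ∈ A then 1 else 0)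
      + (if mix (i + 1) w b ∈ A then 1 else 0)) := by
    intro v w hv hw
    have hwi : w i = b i + 1 := by simp [hw, hv]
    have h2 : b i + 1 + 1 = b i := by rw [add_assoc, CharTwo.add_self_eq_zero, add_zero]
    have e := mix_succ_of_eq (v := v) (b := b) hv
    unfold predict
    rw [e, hv, hwi, add_zero, add_zero]
    by_cases h3 : mix i v b ∈ A <;> by_cases h4 : mix (i + 1) w b ∈ A <;>
      simp [h3, h4, h2] <;> norm_num
  by_cases hv : v i = b i
  · exact main v _ hv (flipBit_eq_update i v)
  · have hv' : flipBit i v i = b i := by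
      rw [flipBit_eq_update, Function.update_self]
      revert hv
      generalize v i = x
      generalize b i = y
      revert x y
      decide
    have := main (flipBit i v) v hv' (by
      rw [flipBit_eq_update]
      simp [add_assoc, CharTwo.add_self_eq_zero])
    rw [flipBit_eq_update i v, mix_update, ← flipBit_eq_update] at this
    linarith

/-- `predict_pair` summed over `v`: flipping a bit permutes the strings, so both members of a pair
give the same sum. -/
theorem two_mul_sum_predict (A : Set (Str m)) (b : Ω → Str m) (i : Fin m) :
    2 * ∑ ω, ∑ v, (if predict A i v 0 (b ω) = b ω i then (1 : ℝ) else 0) =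
      Fintype.card Ω * 2 ^ m + 2 * (hybrid A b i - hybrid A b (i + 1)) := by
  classical
  have h : ∀ ω, 2 * ∑ v, (if predict A i v 0 (b ω) = b ω i then (1 : ℝ) else 0) =
      2 ^ m + 2 * ((∑ v, if mix i v (b ω) ∈ A then 1 else 0) -
        ∑ v, if mix (i + 1) v (b ω) ∈ A then 1 else 0) := by
    intro ω
    have e1 := Equiv.sum_comp (flipBit i)
      fun v => (if predict A i v 0 (b ω) = b ω i then (1 : ℝ) else 0)
    have e2 := Equiv.sum_comp (flipBit i)
      fun v => (if mix (i + 1) v (b ω) ∈ A then (1 : ℝ) else 0)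
    have e3 := sum_congr rfl fun v (_ : v ∈ univ) => predict_pair A i v (b ω)
    simp only [sum_add_distrib, sum_sub_distrib, ← mul_sum] at e3
    simp only [sum_const, card_univ, Fintype.card_fun, Fintype.card_fin, ZMod.card] at e3
    rw [e1, e2] at e3
    simp only [nsmul_eq_mul, mul_one] at e3
    push_cast at e3
    linarith
  rw [mul_sum, sum_congr rfl fun ω _ => h ω, sum_add_distrib, ← mul_sum, sum_sub_distrib]
  simp only [hybrid, sum_const, card_univ, nsmul_eq_mul]

/-- The predictors for `s = 0` and `s = 1` are complementary. This makes a negative hybrid gap as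
useful as a positive one. -/
theorem sum_predict_add (A : Set (Str m)) (b : Ω → Str m) (i : Fin m) :
    ∑ ω, ∑ v, (if predict A i v 0 (b ω) = b ω i then (1 : ℝ) else 0) +
    ∑ ω, ∑ v, (if predict A i v 1 (b ω) = b ω i then (1 : ℝ) else 0) =
      Fintype.card Ω * 2 ^ m := by
  rw [← sum_add_distrib]
  simp_rw [← sum_add_distrib]
  have h : ∀ v b, ((if predict A i v 0 b = b i then (1 : ℝ) else 0) +
      if predict A i v 1 b = b i then (1 : ℝ) else 0) = 1 := by
    intro v b
    have e : predict A i v 1 b = predict A i v 0 b + 1 := by unfold predict; ring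
    rw [e]
    generalize predict A i v 0 b = x
    generalize b i = y
    rcases eq_zero_or_one x with rfl | rfl <;> rcases eq_zero_or_one y with rfl | rfl <;>
      simp [CharTwo.add_self_eq_zero]
  simp [h]

open Classical in
/-- A distinguisher yields a predictor of some bit from the following ones. -/
theorem exists_predict [Nonempty Ω] (A : Set (Str m)) (b : Ω → Str m) (ε : ℝ) (hm : 0 < m)
    (h : ε < |(#{ω | b ω ∈ A} : ℝ) / Fintype.card Ω - (#{v | v ∈ A} : ℝ) / 2 ^ m|) :
    ∃ i v s, (1 / 2 + ε / m) * Fintype.card Ω ≤ (#{ω | predict A i v s (b ω) = b ω i} : ℝ) := by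
  have hΩ : (0 : ℝ) < Fintype.card Ω := by exact_mod_cast Fintype.card_pos
  have hM : (0 : ℝ) < 2 ^ m := by positivity
  have hm' : (0 : ℝ) < m := by exact_mod_cast hm
  have h0 : hybrid A b 0 = 2 ^ m * #{ω | b ω ∈ A} := by
    have : ∀ v b : Str m, mix 0 v b = b := fun v b => by funext j; simp [mix]
    simp only [hybrid, this, sum_const, card_univ, Fintype.card_fun, Fintype.card_fin,
      ZMod.card, ← smul_sum, sum_boole]
    simp
  have h1 : hybrid A b m = Fintype.card Ω * #{v | v ∈ A} := by
    have : ∀ v b : Str m, mix m v b = v := fun v b => by funext j; simp [mix]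
    simp [hybrid, this]
  -- The hybrids telescope from the true output (`0`) to a uniform string (`m`), so one of the `m`
  -- gaps has at least the average size.
  obtain ⟨i, hi⟩ : ∃ i : Fin m,
      ε / m * (Fintype.card Ω * 2 ^ m) ≤ |hybrid A b i - hybrid A b (i + 1)| := by
    by_contra! hcon
    have h2 : |hybrid A b 0 - hybrid A b m| ≤ ε * (Fintype.card Ω * 2 ^ m) := by
      rw [← sum_range_sub', ← Fin.sum_univ_eq_sum_range
        (fun i => hybrid A b i - hybrid A b (i + 1))]
      refine (abs_sum_le_sum_abs _ _).trans ((sum_le_sum fun i _ => (hcon i).le).trans ?_)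
      simp only [sum_const, card_univ, Fintype.card_fin, nsmul_eq_mul]
      apply le_of_eq
      field_simp
    have h3 : hybrid A b 0 - hybrid A b m = ((#{ω | b ω ∈ A} : ℝ) / Fintype.card Ω -
        (#{v | v ∈ A} : ℝ) / 2 ^ m) * (Fintype.card Ω * 2 ^ m) := by
      rw [h0, h1]; field_simp
    rw [h3, abs_mul, abs_of_pos (mul_pos hΩ hM)] at h2
    exact absurd (le_of_mul_le_mul_right h2 (mul_pos hΩ hM)) (not_le.mpr h)
  obtain ⟨s, hs⟩ : ∃ s : ZMod 2, (1 / 2 + ε / m) * Fintype.card Ω * 2 ^ m ≤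
      ∑ ω, ∑ v, (if predict A i v s (b ω) = b ω i then (1 : ℝ) else 0) := by
    have e1 := two_mul_sum_predict A b i
    have e2 := sum_predict_add A b i
    rcases le_abs.mp hi with h | h
    · refine ⟨0, ?_⟩
      convert (by linarith : (1 / 2 + ε / m) * Fintype.card Ω * 2 ^ m ≤
        ∑ ω, ∑ v, (if predict A i v 0 (b ω) = b ω i then (1 : ℝ) else 0))
    · refine ⟨1, ?_⟩
      convert (by linarith : (1 / 2 + ε / m) * Fintype.card Ω * 2 ^ m ≤
        ∑ ω, ∑ v, (if predict A i v 1 (b ω) = b ω i then (1 : ℝ) else 0))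
  -- Averaging over `v` fixes the random bits of the predictor.
  rw [sum_comm] at hs
  obtain ⟨v, -, hv⟩ := exists_le_of_sum_le (s := (univ : Finset (Str m)))
    (f := fun _ => (1 / 2 + ε / m) * Fintype.card Ω) univ_nonempty
    (by simpa [mul_comm] using hs)
  exact ⟨i, v, s, by convert hv⟩

end Hybrid

/-! ### The swap procedure is injective -/

section Shuffle

/-- The permutation `swap i₁ (Y i₁) * swap i₂ (Y i₂) * ⋯` for a list of indices. -/
def swapFold {α : Type*} [DecidableEq α] (Y : α → α) (l : List α) : Equiv.Perm α :=
  l.foldl (fun R i => R * Equiv.swap i (Y i)) 1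

theorem swapFold_append_singleton {α : Type*} [DecidableEq α] (Y : α → α) (l : List α) (a : α) :
    swapFold Y (l ++ [a]) = swapFold Y l * Equiv.swap a (Y a) := by
  simp [swapFold]

variable {α : Type*} [LinearOrder α]

theorem swapFold_apply_of_forall_lt (Y : α → α) (hY : ∀ i, Y i ≤ i) (a : α) (l : List α)
    (h : ∀ i ∈ l, i < a) : swapFold Y l a = a := by
  induction l using List.reverseRecOn with
  | nil => rfl
  | append_singleton l b ih =>
    have hb : b < a := h b (by simp)
    rw [swapFold_append_singleton, Equiv.Perm.mul_apply,
      Equiv.swap_apply_of_ne_of_ne hb.ne' ((hY b).trans_lt hb).ne',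
      ih fun i hi => h i (by simp [hi])]

/-- The swap procedure does not lose information. -/
theorem swapFold_injective {Y Y' : α → α} (hY : ∀ i, Y i ≤ i) (hY' : ∀ i, Y' i ≤ i)
    (l : List α) (hl : l.Pairwise (· < ·)) (h : swapFold Y l = swapFold Y' l) :
    ∀ i ∈ l, Y i = Y' i := by
  induction l using List.reverseRecOn with
  | nil => simp
  | append_singleton l a ih =>
    rw [List.pairwise_append] at hl
    have hlt : ∀ i ∈ l, i < a := fun i hi => hl.2.2 i hi a (by simp)
    -- The last swap sends `Y a` to `a` and the earlier ones fix `a`, so `Y a` is read off as the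
    -- preimage of `a`.
    have e : ∀ Y : α → α, (∀ i, Y i ≤ i) → swapFold Y (l ++ [a]) (Y a) = a := by
      intro Y hY
      rw [swapFold_append_singleton, Equiv.Perm.mul_apply, Equiv.swap_apply_right,
        swapFold_apply_of_forall_lt Y hY a l hlt]
    have ha : Y a = Y' a := by
      refine (swapFold Y (l ++ [a])).injective ?_
      rw [e Y hY, h, e Y' hY']
    rw [swapFold_append_singleton, swapFold_append_singleton, ha] at h
    intro i hi
    rcases List.mem_append.mp hi with hi | hi
    · exact ih hl.1 (mul_right_cancel h) i hi
    · rw [List.mem_singleton.mp hi, ha]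

end Shuffle

/-! ### Recovering the truth-table from the circular permutation -/

section Cycle

theorem exists_finRotate_pow {N : ℕ} [NeZero N] (x : Fin N) : ∃ k : ℕ, (finRotate N ^ k) 0 = x := by
  obtain ⟨M, rfl⟩ := Nat.exists_eq_succ_of_ne_zero (NeZero.ne N)
  have h : ∀ (k : ℕ) (hk : k < M + 1), (finRotate (M + 1) ^ k) 0 = ⟨k, hk⟩ := by
    intro k
    induction k with
    | zero => exact fun _ => rfl
    | succ k ih =>
      intro hk
      rw [pow_succ', Equiv.Perm.mul_apply, ih (by omega), finRotate_of_lt (by omega)]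
  exact ⟨x, h x x.isLt⟩

theorem permCongr_pow_apply {α β : Type*} (c : α ≃ β) (f : Equiv.Perm α) (k : ℕ) (a : α) :
    (c.permCongr f ^ k) (c a) = c ((f ^ k) a) := by
  induction k with
  | zero => rfl
  | succ k ih => rw [pow_succ', pow_succ', Equiv.Perm.mul_apply, Equiv.Perm.mul_apply, ih]; simp

/-- The conjugate of a transitive permutation determines the conjugating map along the whole orbit
once one value is fixed. -/
theorem eq_of_permCongr_eq {α β : Type*} {c c' : α ≃ β} {f : Equiv.Perm α} {a : α}
    (hf : ∀ x, ∃ k : ℕ, (f ^ k) a = x) (ha : c a = c' a) (h : c.permCongr f = c'.permCongr f) :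
    c = c' := by
  ext x
  obtain ⟨k, rfl⟩ := hf x
  rw [← permCongr_pow_apply, ← permCongr_pow_apply, h, ha]

theorem cycleOrder_zero (n : ℕ) (P : Equiv.Perm (Fin (2 ^ n - 1))) : cycleOrder n P 0 = 0 := by
  have e : (finCongr (Nat.sub_add_cancel (Nat.one_le_two_pow (n := n)))).symm 0 = 0 := by
    ext; simp
  rw [cycleOrder, Equiv.permCongr_apply, e]
  ext; simp

theorem cycleOrder_injective (n : ℕ) : Function.Injective (cycleOrder n) := by
  intro P P' h
  have := Equiv.Perm.decomposeFin.symm.injective ((Equiv.permCongr _).injective h)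
  simpa using this

variable {n : ℕ}

theorem swapPerm_eq_of_circPerm_eq {X X' : Str (2 ^ n * n)} (h : circPerm X = circPerm X') :
    swapPerm X = swapPerm X' := by
  have h1 := (Equiv.permCongr _).injective h
  exact cycleOrder_injective n (eq_of_permCongr_eq exists_finRotate_pow
    (by rw [cycleOrder_zero, cycleOrder_zero]) h1)

theorem swapIndex_eq_of_circPerm_eq {X X' : Str (2 ^ n * n)} (h : circPerm X = circPerm X') :
    swapIndex X = swapIndex X' := by
  have hle : ∀ (X : Str (2 ^ n * n)) i, swapIndex X i ≤ i := fun X i =>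
    Nat.lt_succ_iff.mp (Nat.mod_lt _ (Nat.succ_pos _))
  funext i
  exact swapFold_injective (hle X) (hle X') (List.finRange (2 ^ n - 1))
    (List.pairwise_lt_finRange _) (swapPerm_eq_of_circPerm_eq h) i (List.mem_finRange i)

theorem exists_circPerm_inv_pow (X : Str (2 ^ n * n)) (y : Str n) :
    ∃ k : ℕ, ((circPerm X)⁻¹ ^ k) ((rank n).symm 0) = y := by
  set c := (cycleOrder n (swapPerm X)).trans (rank n).symm with hc
  have e : circPerm X = c.permCongr (finRotate (2 ^ n)) := by
    ext; rfl
  have h0 : c 0 = (rank n).symm 0 := by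
    rw [hc, Equiv.trans_apply, cycleOrder_zero]
  obtain ⟨k, hk⟩ := exists_finRotate_pow (c.symm y)
  have h1 : (circPerm X ^ k) ((rank n).symm 0) = y := by
    rw [← h0, e, permCongr_pow_apply, hk, Equiv.apply_symm_apply]
  -- In a finite group every power of an element is also a nonnegative power of its inverse.
  have h2 : circPerm X ^ k ∈ Submonoid.powers (circPerm X)⁻¹ := by
    rw [mem_powers_iff_mem_zpowers, Subgroup.zpowers_inv]
    exact Subgroup.npow_mem_zpowers _ _
  obtain ⟨j, hj⟩ := h2
  exact ⟨j, by simpa [← h1] using congrArg (fun f => f ((rank n).symm 0)) hj⟩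

theorem block_ext {a b : ℕ} {s s' : Str (a * b)} (h : ∀ i, block s i = block s' i) : s = s' := by
  funext k
  have := congrFun (h (finProdFinEquiv.symm k).1) (finProdFinEquiv.symm k).2
  rwa [block, block, Prod.mk.eta, Equiv.apply_symm_apply] at this

/-- What is needed to recover `X` from the permutation that it determines. -/
def residue (X : Str (2 ^ n * n)) :
    Str n × (∀ i : Fin (2 ^ n), Fin (2 ^ n / (i + 1) + 1)) :=
  (block X (Fin.last _ |>.cast (Nat.sub_add_cancel Nat.one_le_two_pow)), fun i =>
    ⟨tableValue X i / (i + 1), Nat.lt_succ_of_le (Nat.div_le_div_right (rank n (block X i)).isLt)⟩)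

/-- The permutation gives `X(i) mod i` for `i < N` and the residue gives the quotients; the entry
`X(N)`, which the procedure never reads, is kept in full. -/
theorem circPerm_residue_injective :
    Function.Injective fun X : Str (2 ^ n * n) => (circPerm X, residue X) := by
  intro X X' h
  obtain ⟨h1, h2⟩ := Prod.mk.inj h
  obtain ⟨h3, h4⟩ := Prod.mk.inj h2
  refine block_ext fun i => ?_
  by_cases hi : (i : ℕ) < 2 ^ n - 1
  · have e1 := congrArg Fin.val (congrFun (swapIndex_eq_of_circPerm_eq h1) ⟨i, hi⟩)
    have e2 := congrArg Fin.val (congrFun h4 i)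
    change tableValue X i % (i + 1) = tableValue X' i % (i + 1) at e1
    change tableValue X i / (i + 1) = tableValue X' i / (i + 1) at e2
    have e3 : tableValue X i = tableValue X' i := by
      rw [← Nat.div_add_mod (tableValue X i) (i + 1), e1, e2, Nat.div_add_mod]
    exact (rank n).injective (Fin.ext (Nat.succ_injective e3))
  · have e : i = (Fin.last _).cast (Nat.sub_add_cancel Nat.one_le_two_pow) := by
      ext; simp; omega
    rw [e]; exact h3

/-- After multiplication by `N!` the factor `i` becomes at most `N + 1 + i`, and the product of
these is `N!` times the central binomial coefficient of `2 * N`. -/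
theorem prod_div_add_one_le (N : ℕ) : ∏ i : Fin N, (N / (i + 1) + 1) ≤ 4 ^ N := by
  rw [Fin.prod_univ_eq_prod_range (fun i => N / (i + 1) + 1)]
  have h : N.factorial * ∏ i ∈ range N, (N / (i + 1) + 1) ≤ N.factorial * 4 ^ N := by
    calc N.factorial * ∏ i ∈ range N, (N / (i + 1) + 1)
        = ∏ i ∈ range N, ((i + 1) * (N / (i + 1) + 1)) := by
          rw [prod_mul_distrib, prod_range_add_one_eq_factorial]
      _ ≤ ∏ i ∈ range N, (N + 1 + i) := by
          refine prod_le_prod' fun i _ => ?_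
          have := Nat.mul_div_le N (i + 1)
          linarith
      _ = N.factorial * (N + N).choose N := by
          rw [← Nat.ascFactorial_eq_prod_range, Nat.ascFactorial_eq_factorial_mul_choose]
      _ ≤ N.factorial * 4 ^ N := by
          refine Nat.mul_le_mul_left _ ((Nat.choose_le_two_pow _ _).trans ?_)
          rw [← two_mul, pow_mul]; norm_num
  exact Nat.le_of_mul_le_mul_left h (Nat.factorial_pos N)

-- Passing from inputs to permutations loses only `n + 2 * N` bits: `n` for the last entry and `2 *
-- N` for all the quotients.
open Classical in
theorem card_le_card_circPerm (S : Finset (Str (2 ^ n * n))) :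
    #S ≤ #(S.image circPerm) * (2 ^ n * 4 ^ 2 ^ n) := by
  have h := card_le_card_of_injOn (s := S) (t := S.image circPerm ×ˢ univ)
    (fun X => (circPerm X, residue X))
    (fun X hX => mem_product.mpr ⟨mem_image_of_mem _ hX, mem_univ _⟩)
    circPerm_residue_injective.injOn
  refine h.trans ?_
  rw [card_product, card_univ, Fintype.card_prod]
  refine Nat.mul_le_mul_left _ (Nat.mul_le_mul (by simp) ?_)
  simpa [Fintype.card_pi] using prod_div_add_one_le (2 ^ n)

end Cycle

/-! ### From counting failing inputs to min-entropy sources -/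

section Averaging

theorem prob_uniformOfFintype {k : ℕ} (A : Set (Str k)) [DecidablePred (· ∈ A)] :
    prob (PMF.uniformOfFintype (Str k)) A = #{v | v ∈ A} / 2 ^ k := by
  classical
  rw [prob, PMF.toOuterMeasure_uniformOfFintype_apply, ENNReal.toReal_div]
  simp [Fintype.card_subtype]

open Classical in
theorem prob_outputDist {a d m : ℕ} (E : Str a → Str d → Str m) (X : PMF (Str a))
    (A : Set (Str m)) :
    prob (outputDist E X) A = ∑ x, (X x).toReal * (#{y | E x y ∈ A} / 2 ^ d) := by
  rw [prob, outputDist, PMF.toOuterMeasure_bind_apply, tsum_fintype, ENNReal.toReal_sum]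
  · refine sum_congr rfl fun x _ => ?_
    rw [ENNReal.toReal_mul, PMF.toOuterMeasure_map_apply]
    exact congrArg _ (prob_uniformOfFintype (E x ⁻¹' A))
  · intro x _
    refine ENNReal.mul_ne_top (X.apply_ne_top x) ?_
    rw [PMF.toOuterMeasure_map_apply, PMF.toOuterMeasure_uniformOfFintype_apply]
    refine ENNReal.div_ne_top (by simp) (by simp)

theorem sum_toReal {a : ℕ} (X : PMF (Str a)) : ∑ x, (X x).toReal = 1 := by
  rw [← ENNReal.toReal_sum fun x _ => X.apply_ne_top x, ← tsum_fintype (L := .unconditional _),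
    X.tsum_coe, ENNReal.toReal_one]

theorem toReal_le_of_le_minEntropy {a : ℕ} (X : PMF (Str a)) {k : ℝ} (hk : k ≤ minEntropy X)
    (x : Str a) : (X x).toReal ≤ 2 ^ (-k) := by
  by_cases hx : x ∈ X.support
  · have hpos : 0 < (X x).toReal :=
      ENNReal.toReal_pos ((PMF.mem_support_iff _ _).mp hx) (X.apply_ne_top x)
    have h1 : k ≤ Real.logb 2 (1 / (X x).toReal) :=
      hk.trans (ciInf_le (Set.finite_range _).bddBelow (⟨x, hx⟩ : X.support))
    rw [one_div, Real.logb_inv, le_neg] at h1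
    exact (Real.logb_le_iff_le_rpow one_lt_two hpos).mp h1
  · rw [(PMF.apply_eq_zero_iff _ _).mpr hx, ENNReal.toReal_zero]
    positivity

theorem abs_card_div_sub_card_div_le_one {d m : ℕ} (F : Finset (Str d)) (G : Finset (Str m)) :
    |(#F : ℝ) / 2 ^ d - (#G : ℝ) / 2 ^ m| ≤ 1 := by
  have h1 : ∀ (k : ℕ) (F : Finset (Str k)), (#F : ℝ) / 2 ^ k ≤ 1 := by
    intro k F
    rw [div_le_one (by positivity)]
    have := card_le_univ F
    rw [Fintype.card_fun, ZMod.card, Fintype.card_fin] at this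
    exact_mod_cast this
  have h2 := h1 m G
  have h3 := h1 d F
  have h4 : 0 ≤ (#G : ℝ) / 2 ^ m := by positivity
  have h5 : 0 ≤ (#F : ℝ) / 2 ^ d := by positivity
  rw [abs_le]; constructor <;> linarith

open Classical in
/-- A function is an extractor if, for every test, few inputs fail it. -/
theorem isExtractor_of_card_le {a d m : ℕ} (E : Str a → Str d → Str m) {k ε : ℝ}
    (h : ∀ A : Set (Str m), (#{x | ε < |(#{y | E x y ∈ A} : ℝ) / 2 ^ d -
      (#{v | v ∈ A} : ℝ) / 2 ^ m|} : ℝ) ≤ ε * 2 ^ k) :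
    IsExtractor k (2 * ε) E := by
  intro X hX
  refine ciSup_le fun A => ?_
  set u : ℝ := (#{v | v ∈ A} : ℝ) / 2 ^ m with hu
  set q : Str a → ℝ := fun x => (#{y | E x y ∈ A} : ℝ) / 2 ^ d with hq
  set B : Finset (Str a) := {x | ε < |q x - u|} with hB
  have hq1 : ∀ x, |q x - u| ≤ 1 := fun x => abs_card_div_sub_card_div_le_one _ _
  have e : prob (outputDist E X) A - prob (PMF.uniformOfFintype (Str m)) A =
      ∑ x, (X x).toReal * (q x - u) := by
    rw [prob_outputDist, prob_uniformOfFintype]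
    simp_rw [mul_sub, sum_sub_distrib, ← sum_mul, sum_toReal, one_mul]
    rfl
  rw [e]
  -- At most `ε * 2 ^ k` failing inputs, each of probability at most `2 ^ (-k)`.
  have hBX : ∑ x ∈ B, (X x).toReal ≤ ε := by
    calc ∑ x ∈ B, (X x).toReal ≤ ∑ x ∈ B, (2 : ℝ) ^ (-k) :=
          sum_le_sum fun x _ => toReal_le_of_le_minEntropy X hX x
      _ = #B * 2 ^ (-k) := by rw [sum_const, nsmul_eq_mul]
      _ ≤ ε * 2 ^ k * 2 ^ (-k) := by gcongr; exact h A
      _ = ε := by rw [mul_assoc, ← Real.rpow_add two_pos]; simp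
  have hε : 0 ≤ ε := (sum_nonneg fun _ _ => ENNReal.toReal_nonneg).trans hBX
  calc |∑ x, (X x).toReal * (q x - u)| ≤ ∑ x, |(X x).toReal * (q x - u)| := abs_sum_le_sum_abs _ _
    _ ≤ ∑ x, ((X x).toReal * ε + if x ∈ B then (X x).toReal else 0) := by
        refine sum_le_sum fun x _ => ?_
        rw [abs_mul, abs_of_nonneg ENNReal.toReal_nonneg]
        have h0 : 0 ≤ (X x).toReal := ENNReal.toReal_nonneg
        split_ifs with hx
        · nlinarith [hq1 x, mul_nonneg h0 hε]
        · have : |q x - u| ≤ ε := by simpa [hB] using hx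
          nlinarith
    _ ≤ 2 * ε := by
        rw [sum_add_distrib, ← sum_mul, sum_toReal, ← sum_filter, filter_mem_eq_inter,
          univ_inter]
        linarith

end Averaging

/-! ### From a failed test to inversion of the direct product -/

section Reduction

/-- Splitting a string into blocks. -/
def blockEquiv (a b : ℕ) : Str (a * b) ≃ (Fin a → Str b) where
  toFun := block
  invFun := concat
  left_inv s := block_ext fun i => by funext j; simp [block, concat]
  right_inv f := by funext i j; simp [block, concat]

theorem directProduct_iterate {n : ℕ} (ℓ : ℕ) (R : Equiv.Perm (Str n)) (k : ℕ) (x : Str (ℓ * n)) :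
    (directProduct ℓ R)^[k] x = concat fun a => (R ^ k) (block x a) := by
  induction k with
  | zero => exact ((blockEquiv ℓ n).symm_apply_apply x).symm
  | succ k ih =>
    rw [Function.iterate_succ_apply', ih, directProduct]
    congr 1
    funext a
    rw [pow_succ', Equiv.Perm.mul_apply]
    exact congrArg R (congrFun ((blockEquiv ℓ n).apply_symm_apply fun a => (R ^ k) (block x a)) a)

/-- The prediction of output bit `p.1` from the forward orbits `o` of the image of the state
that produces this bit. -/
noncomputable def predictOrbit {n ℓ m : ℕ} (A : Set (Str m)) (p : Fin m × Str m × ZMod 2)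
    (o : Fin ℓ → Fin m → Str n) (r : Str (ℓ * n)) : ZMod 2 :=
  predict A p.1 p.2.1 p.2.2 fun j =>
    dotProduct r (concat fun a => o a ⟨j - (p.1 + 1), (Nat.sub_le _ _).trans_lt j.isLt⟩)

/-- For `j > i`, `R̄^j(x̄)` is the iterate number `j - (i + 1)` of `R̄^(i+1)(x̄)`, so the later bits
are visible on its forward orbit. -/
theorem predict_extractor {n ℓ m : ℕ} (A : Set (Str m)) (i : Fin m) (v : Str m) (s : ZMod 2)
    (X : Str (2 ^ n * n)) (seed : Str (2 * (ℓ * n))) :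
    predict A i v s (extractor n ℓ m X seed) = predictOrbit A (i, v, s)
      (fun a => orbit m (circPerm X) ((circPerm X ^ ((i : ℕ) + 1)) (block (block seed 0) a)))
      (block seed 1) := by
  refine predict_congr A i v s fun j hj => ?_
  simp only [extractor, directProduct_iterate, orbit]
  congr 2
  funext a
  rw [← Equiv.Perm.mul_apply, ← pow_add]
  congr 2
  have : (i : ℕ) < j := hj
  omega

theorem extractor_apply {n ℓ m : ℕ} (i : Fin m) (X : Str (2 ^ n * n)) (seed : Str (2 * (ℓ * n))) :
    extractor n ℓ m X seed i = dotProduct (block seed 1) (concat fun a =>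
      (circPerm X)⁻¹ ((circPerm X ^ ((i : ℕ) + 1)) (block (block seed 0) a))) := by
  simp only [extractor, directProduct_iterate]
  congr 2
  funext a
  rw [pow_succ', Equiv.Perm.mul_apply]
  simp

/-- A seed as a pair of the image of its first half under `R` and its second half. -/
def seedEquiv {n ℓ : ℕ} (R : Equiv.Perm (Str n)) :
    Str (2 * (ℓ * n)) ≃ (Fin ℓ → Str n) × Str (ℓ * n) :=
  ((blockEquiv 2 (ℓ * n)).trans (finTwoArrowEquiv _)).trans
    (((blockEquiv ℓ n).trans (Equiv.piCongrRight fun _ => R)).prodCongr (Equiv.refl _))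

theorem seedEquiv_apply {n ℓ : ℕ} (R : Equiv.Perm (Str n)) (seed : Str (2 * (ℓ * n))) :
    seedEquiv R seed = (fun a => R (block (block seed 0) a), block seed 1) := rfl

open Classical in
/-- A distinguisher for the output bits inverts the direct product on a dense set. -/
theorem exists_dense_of_distinguish {n ℓ m : ℕ} (hm : 0 < m) (A : Set (Str m)) (ε : ℝ)
    (X : Str (2 ^ n * n))
    (h : ε < |(#{y | extractor n ℓ m X y ∈ A} : ℝ) / 2 ^ (2 * (ℓ * n)) -
      (#{v | v ∈ A} : ℝ) / 2 ^ m|) :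
    ∃ p, ε / m * (2 ^ n) ^ ℓ ≤ (#{y : Fin ℓ → Str n | (concat fun a => (circPerm X)⁻¹ (y a)) ∈
      agreeing (ε / m) (predictOrbit A p fun a => orbit m (circPerm X) (y a))} : ℝ) := by
  obtain ⟨i, v, s, hp⟩ := exists_predict A (extractor n ℓ m X) ε hm (by simpa using h)
  refine ⟨(i, v, s), ?_⟩
  set R := circPerm X with hR
  set η := ε / m with hη
  let c : (Fin ℓ → Str n) → ℕ := fun y =>
    #{r | predictOrbit A (i, v, s) (fun a => orbit m R (y a)) r =
      dotProduct r (concat fun a => R⁻¹ (y a))}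
  have e : #{seed | predict A i v s (extractor n ℓ m X seed) = extractor n ℓ m X seed i} =
      ∑ y, c y := by
    have e1 : ∑ y, c y = #{q : (Fin ℓ → Str n) × Str (ℓ * n) |
        predictOrbit A (i, v, s) (fun a => orbit m R (q.1 a)) q.2 =
          dotProduct q.2 (concat fun a => R⁻¹ (q.1 a))} := by
      rw [card_filter, Fintype.sum_prod_type]
      exact sum_congr rfl fun y _ => card_filter _ _
    rw [e1]
    -- Since `R` is a bijection, `R̄^(i+1)(x̄)` is uniform when `x̄` is, so seeds can be counted by
    -- it.
    refine card_equiv (seedEquiv (R ^ ((i : ℕ) + 1))) fun seed => ?_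
    simp only [mem_filter, mem_univ, true_and, predict_extractor, extractor_apply,
      seedEquiv_apply, hR]
  set G : Finset (Fin ℓ → Str n) := {y | (concat fun a => R⁻¹ (y a)) ∈
      agreeing η (predictOrbit A (i, v, s) fun a => orbit m R (y a))} with hG
  set M : ℝ := 2 ^ (ℓ * n) with hM
  have hM0 : 0 < M := by positivity
  have hc1 : ∀ y, (c y : ℝ) ≤ M := by
    intro y
    have := card_le_univ ({r | predictOrbit A (i, v, s) (fun a => orbit m R (y a)) r =
      dotProduct r (concat fun a => R⁻¹ (y a))} : Finset (Str (ℓ * n)))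
    rw [Fintype.card_fun, ZMod.card, Fintype.card_fin] at this
    calc (c y : ℝ) ≤ ((2 ^ (ℓ * n) : ℕ) : ℝ) := Nat.cast_le.mpr this
      _ = M := by push_cast; rfl
  have hc2 : ∀ y ∉ G, (c y : ℝ) ≤ (1 / 2 + η / 2) * M := by
    intro y hy
    simp only [hG, agreeing, mem_filter, mem_univ, true_and, not_le, Fintype.card_fin] at hy
    exact hy.le
  -- Outside `G` the agreement is at most `1 / 2 + η / 2`, inside at most `1`. An average of `1 / 2
  -- + η` thus forces density `η` on `G`.
  have hsum : ∑ y, (c y : ℝ) ≤ ∑ y, ((1 / 2 + η / 2) * M +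
      if y ∈ G then (1 / 2 - η / 2) * M else 0) := by
    refine sum_le_sum fun y _ => ?_
    split_ifs with hy
    · linarith [hc1 y]
    · linarith [hc2 y hy]
  rw [e] at hp
  push_cast at hp
  have h1 := hp.trans hsum
  rw [sum_add_distrib, ← sum_filter, filter_mem_eq_inter, univ_inter, sum_const, sum_const,
    nsmul_eq_mul, nsmul_eq_mul, card_univ, Fintype.card_fun, Fintype.card_fun, Fintype.card_fun,
    Fintype.card_fin, Fintype.card_fin, Fintype.card_fin, ZMod.card] at h1
  push_cast at h1
  have e2 : (2 : ℝ) ^ (2 * (ℓ * n)) = (2 ^ n) ^ ℓ * M := by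
    rw [hM, ← pow_mul, ← pow_add]; congr 1; ring
  rw [e2] at h1
  have h2 : (1 / 2 + η) * (2 ^ n) ^ ℓ ≤ (2 ^ n) ^ ℓ * (1 / 2 + η / 2) + #G * (1 / 2 - η / 2) :=
    le_of_mul_le_mul_right (by linarith) hM0
  have h3 : 0 ≤ η ∨ η < 0 := le_or_gt 0 η
  have h4 : (0 : ℝ) ≤ #G := by positivity
  rcases h3 with h3 | h3
  · nlinarith
  · have : (0 : ℝ) < (2 ^ n) ^ ℓ := by positivity
    nlinarith

open Classical in
/-- Few inputs fail a test. -/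
theorem card_distinguish_le {n ℓ m L T h : ℕ} (hm : 0 < m) (hℓ : 0 < ℓ) (hL : 0 < L) (hT0 : 0 < T)
    (τ ε : ℝ) (hε : 0 < ε) (hτ0 : 0 ≤ τ) (hτ : τ ≤ 1) (hL' : 1 / (ε / m) ^ 2 ≤ L)
    (hη : ((2 : ℝ) ^ n - h) ^ ℓ + ℓ * (τ * (2 ^ n) ^ ℓ) < ε / m * (2 ^ n) ^ ℓ)
    (hT : 2 ^ n * (1 - τ) ^ T < 1) (A : Set (Str m)) :
    #{X | ε < |(#{y | extractor n ℓ m X y ∈ A} : ℝ) / 2 ^ (2 * (ℓ * n)) -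
      (#{v | v ∈ A} : ℝ) / 2 ^ m|} ≤
    (m * (2 ^ m * 2)) * ((2 ^ n) ^ m * ((((2 ^ n) ^ m) ^ ℓ) ^ T *
      ((2 ^ n) ^ h * ((2 ^ n) ^ h * (T * (ℓ * L)) ^ 2 ^ n)))) * (2 ^ n * 4 ^ 2 ^ n) := by
  have hm0 : (0 : ℝ) < m := by exact_mod_cast hm
  refine (card_le_card_circPerm _).trans (Nat.mul_le_mul_right _ ?_)
  -- The decoder enumerates the linear functions close to the predictor. Only their number matters,
  -- not how they are found.
  have hlist : ∀ (p : Fin m × Str m × ZMod 2) (o : Fin ℓ → Fin m → Str n),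
      ∃ f : Fin L → Fin ℓ → Str n, ∀ z : Fin ℓ → Str n,
        concat z ∈ agreeing (ε / m) (predictOrbit A p o) → ∃ i, f i = z := by
    intro p o
    obtain ⟨f, hf⟩ := exists_subset_range (L := L) (agreeing (ε / m) (predictOrbit A p o))
      (by exact_mod_cast (card_agreeing_le _ (div_pos hε hm0) _).trans hL')
    refine ⟨fun i => block (f i), fun z hz => ?_⟩
    obtain ⟨i, hi⟩ := hf hz
    exact ⟨i, by simp only [hi]; exact (blockEquiv ℓ n).apply_symm_apply z⟩
  choose dec hdec using hlist
  have : Nonempty (Fin m × Str m × ZMod 2) := ⟨⟨0, hm⟩, 0, 0⟩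
  have key := card_invertible_le (V := Str n) (P := Fin m × Str m × ZMod 2) (h := h) hm hℓ hL hT0 τ
    (ε / m) hτ0 hτ ((rank n).symm 0) dec (Finset.image circPerm
      {X | ε < |(#{y | extractor n ℓ m X y ∈ A} : ℝ) / 2 ^ (2 * (ℓ * n)) -
        (#{v | v ∈ A} : ℝ) / 2 ^ m|}) ?_ ?_ (by simpa using hη) (by simpa using hT)
  · simpa using key
  · simp only [mem_image, forall_exists_index, and_imp]
    rintro _ X - rfl y
    exact exists_circPerm_inv_pow X y
  · simp only [mem_image, mem_filter, mem_univ, true_and, forall_exists_index, and_imp]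
    rintro _ X hX rfl
    obtain ⟨p, hp⟩ := exists_dense_of_distinguish hm A ε X hX
    refine ⟨p, ?_⟩
    have e : ((Fintype.card (Str n) : ℕ) : ℝ) = 2 ^ n := by simp
    rw [e]
    refine hp.trans ?_
    norm_cast
    refine card_le_card fun y hy => ?_
    simp only [invertible, mem_filter, mem_univ, true_and] at hy ⊢
    exact hdec _ _ _ hy

end Reduction

/-! ### Numerical bounds on the length of the code -/

section Estimates

theorem eventually_mul_pow_le (c δ : ℝ) (hδ : 0 < δ) (k : ℕ) :
    ∀ᶠ n : ℕ in atTop, c * (n : ℝ) ^ k ≤ 2 ^ (δ * n) := by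
  have hr : |(2 : ℝ) ^ (-δ)| < 1 := by
    rw [abs_of_pos (by positivity)]
    exact Real.rpow_lt_one_of_one_lt_of_neg one_lt_two (by linarith)
  have h := (tendsto_pow_const_mul_const_pow_of_abs_lt_one k hr).const_mul c
  rw [mul_zero] at h
  filter_upwards [h.eventually (gt_mem_nhds one_pos)] with n hn
  have e : ((2 : ℝ) ^ (-δ)) ^ n * 2 ^ (δ * n) = 1 := by
    rw [← Real.rpow_natCast, ← Real.rpow_mul two_pos.le, ← Real.rpow_add two_pos]
    simp
  calc c * (n : ℝ) ^ k = c * (n : ℝ) ^ k * (((2 : ℝ) ^ (-δ)) ^ n * 2 ^ (δ * n)) := by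
        rw [e, mul_one]
    _ = c * ((n : ℝ) ^ k * ((2 : ℝ) ^ (-δ)) ^ n) * 2 ^ (δ * n) := by ring
    _ ≤ 1 * 2 ^ (δ * n) := by gcongr
    _ = 2 ^ (δ * n) := one_mul _

theorem rpow_two_natCast_mul (n : ℕ) (a : ℝ) : ((2 : ℝ) ^ n) ^ a = 2 ^ (a * n) := by
  rw [← Real.rpow_natCast, ← Real.rpow_mul two_pos.le, mul_comm]

/-- Bounds on the number of factors. -/
theorem numFactors_le {lam α β : ℝ} (hδ : 0 < (lam - 4 * β - 3 * α) / 4) (hα : 0 < α) (hβ : 0 < β)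
    {n m : ℕ} {ε : ℝ} (hn : 1 ≤ n) (hm : (m : ℝ) ≤ 2 ^ (α * n)) (hε : 2 ^ (-β * n) ≤ ε) :
    (numFactors lam α β m ε : ℝ) ≤
      (3 / ((lam - 4 * β - 3 * α) / 4) * (1 + α + β) + 1) * n := by
  set δ := (lam - 4 * β - 3 * α) / 4 with hδ'
  have hn' : (1 : ℝ) ≤ n := by exact_mod_cast hn
  have hε0 : 0 < ε := lt_of_lt_of_le (by positivity) hε
  have hlog : Real.logb 2 (2 * m * (1 / ε)) ≤ (1 + α + β) * n := by
    rcases Nat.eq_zero_or_pos m with rfl | hm0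
    · simp; positivity
    · have hm0' : (0 : ℝ) < m := by exact_mod_cast hm0
      rw [Real.logb_le_iff_le_rpow one_lt_two (by positivity)]
      have h1 : 1 / ε ≤ 2 ^ (β * n) := by
        rw [div_le_iff₀ hε0]
        calc (1 : ℝ) = 2 ^ (β * n) * 2 ^ (-β * n) := by
              rw [← Real.rpow_add two_pos]; simp
          _ ≤ 2 ^ (β * n) * ε := by gcongr
      have h2 : (2 : ℝ) ≤ 2 ^ (n : ℝ) := by
        simpa using Real.rpow_le_rpow_of_exponent_le one_le_two hn'
      calc 2 * (m : ℝ) * (1 / ε) ≤ 2 ^ (n : ℝ) * 2 ^ (α * n) * 2 ^ (β * n) := by gcongr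
        _ = 2 ^ ((1 + α + β) * n) := by
            rw [← Real.rpow_add two_pos, ← Real.rpow_add two_pos]; congr 1; ring
  have h3 : 0 ≤ 3 / δ * ((1 + α + β) * n) := by positivity
  calc (numFactors lam α β m ε : ℝ) ≤ (⌈3 / δ * ((1 + α + β) * n)⌉₊ : ℝ) := by
        unfold numFactors
        gcongr
    _ ≤ 3 / δ * ((1 + α + β) * n) + 1 := (Nat.ceil_lt_add_one h3).le
    _ ≤ (3 / δ * (1 + α + β) + 1) * n := by nlinarith

/-- The reason for the choice of `ℓ`: with `η = ε / m` it gives `δ * ℓ ≥ 3 * log₂ (2 / η)`, so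
tuples avoiding a fixed fraction `δ` of the points have density at most `(η / 2) ^ 3 ≤ η / 8`. -/
theorem one_sub_pow_numFactors_le {lam α β : ℝ} (hδ : 0 < (lam - 4 * β - 3 * α) / 4)
    (hδ1 : (lam - 4 * β - 3 * α) / 4 ≤ 1) {m : ℕ} {ε : ℝ} (hm : 0 < m) (hε : 0 < ε)
    (hε1 : ε ≤ 1) :
    (1 - (lam - 4 * β - 3 * α) / 4) ^ numFactors lam α β m ε ≤ ε / m / 8 := by
  set δ := (lam - 4 * β - 3 * α) / 4 with hδ'
  set ℓ := numFactors lam α β m ε with hℓ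
  have hm1 : (1 : ℝ) ≤ m := by exact_mod_cast hm
  set η := ε / m with hη
  have hη0 : 0 < η := by positivity
  have hη1 : η ≤ 1 := by rw [hη, div_le_one (by positivity)]; linarith
  set x := Real.logb 2 (2 * m * (1 / ε)) with hx
  have hxe : (2 : ℝ) ^ x = 2 / η := by
    rw [hx, Real.rpow_logb two_pos (by norm_num) (by positivity), hη]; field_simp
  have hx0 : 0 ≤ x := by
    refine Real.logb_nonneg one_lt_two ?_
    have : 2 * (m : ℝ) * (1 / ε) = 2 / η := by rw [hη]; field_simp
    rw [this, le_div_iff₀ hη0]; linarith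
  have hl : 3 * x ≤ δ * ℓ := by
    have : 3 / δ * x ≤ ℓ := Nat.le_ceil _
    calc 3 * x = δ * (3 / δ * x) := by field_simp
      _ ≤ δ * ℓ := by gcongr
  calc (1 - δ) ^ ℓ ≤ Real.exp (-δ) ^ ℓ :=
        pow_le_pow_left₀ (by linarith) (by linarith [Real.add_one_le_exp (-δ)]) _
    _ = Real.exp (-(δ * ℓ)) := by rw [← Real.exp_nat_mul]; congr 1; ring
    _ ≤ Real.exp (-(3 * x)) := Real.exp_le_exp.mpr (by linarith)
    _ ≤ (2 : ℝ) ^ (-(3 * x)) := by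
        rw [Real.rpow_def_of_pos two_pos]
        refine Real.exp_le_exp.mpr ?_
        nlinarith [Real.log_two_lt_d9, Real.log_two_gt_d9]
    _ = (η / 2) ^ 3 := by
        rw [Real.rpow_neg two_pos.le, mul_comm, Real.rpow_mul two_pos.le, hxe]
        norm_cast
        rw [← inv_pow, inv_div]
    _ ≤ η / 8 := by
        have : η ^ 3 ≤ η := by
          calc η ^ 3 ≤ η ^ 1 := pow_le_pow_of_le_one hη0.le hη1 (by norm_num)
            _ = η := pow_one η
        rw [div_pow]; linarith

/-- Bits for the predictor (`2 * m + 1`), the starting orbit and the stored tuples. The last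
dominate with order `k ^ 4 * 2 ^ ((2 * α + β) * k)`; the constant is `14 = 2 * (4 + 3)`, from `4`
for the small terms and `3` for the tuples. -/
theorem orbit_bits_le {α β δ C m ℓ T : ℝ} {k : ℕ} (hα : 0 < α) (hβ : 0 < β) (hδ : 0 < δ)
    (hn : 1 ≤ (k : ℝ)) (hm1 : 1 ≤ m) (hC : 1 ≤ C) (hm : m ≤ 2 ^ (α * k)) (hℓ0 : 0 ≤ ℓ) (hT0 : 0 ≤ T)
    (hℓ : ℓ ≤ C * k) (hT : T ≤ 3 * C * k ^ 2 * 2 ^ ((α + β) * k))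
    (h1 : 14 * C ^ 2 / δ * (k : ℝ) ^ 3 ≤ 2 ^ ((1 - 2 * α - β) * k)) :
    2 * m + 1 + k * m + k * m * ℓ * T ≤ δ / 2 * (k * 2 ^ k) := by
  set W : ℝ := 2 ^ ((2 * α + β) * k) with hW
  have hmW : m ≤ W := by
    refine hm.trans (Real.rpow_le_rpow_of_exponent_le one_le_two ?_)
    have : 0 ≤ (α + β) * k := by positivity
    linarith
  have hW1 : 1 ≤ W := hm1.trans hmW
  have e1 : m * ℓ * T ≤ 3 * C ^ 2 * k ^ 3 * W := by
    calc m * ℓ * T ≤ 2 ^ (α * k) * (C * k) * (3 * C * k ^ 2 * 2 ^ ((α + β) * k)) := by gcongr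
      _ = 3 * C ^ 2 * k ^ 3 * (2 ^ (α * k) * 2 ^ ((α + β) * k)) := by ring
      _ = 3 * C ^ 2 * k ^ 3 * W := by
          rw [hW, ← Real.rpow_add two_pos]; congr 2; ring
  have e2 : 1 ≤ C ^ 2 * (k : ℝ) ^ 3 :=
    one_le_mul_of_one_le_of_one_le (one_le_pow₀ hC) (one_le_pow₀ hn)
  have e3 : 2 * m + 1 + k * m ≤ 4 * (k * W) := by
    have f1 : W ≤ k * W := le_mul_of_one_le_left (by linarith) hn
    have f2 : k * m ≤ k * W := by gcongr
    linarith
  have e4 : W ≤ C ^ 2 * k ^ 3 * W := le_mul_of_one_le_left (by linarith) e2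
  calc 2 * m + 1 + k * m + k * m * ℓ * T ≤ 4 * (k * W) + k * (m * ℓ * T) := by linarith
    _ ≤ 4 * (k * W) + k * (3 * C ^ 2 * k ^ 3 * W) := by gcongr
    _ = k * (4 * W + 3 * (C ^ 2 * k ^ 3 * W)) := by ring
    _ ≤ k * (4 * (C ^ 2 * k ^ 3 * W) + 3 * (C ^ 2 * k ^ 3 * W)) := by gcongr
    _ = k * (δ / 2 * (14 * C ^ 2 / δ * k ^ 3) * W) := by field_simp; ring
    _ ≤ k * (δ / 2 * 2 ^ ((1 - 2 * α - β) * k) * W) := by gcongr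
    _ = δ / 2 * (k * 2 ^ k) := by
        rw [mul_assoc (δ / 2), hW, ← Real.rpow_add two_pos, ← Real.rpow_natCast]
        ring_nf

/-- The budget in units of `n * N`: `δ / 2` for orbits, `2 * δ` for exceptional points and their
preimages, `δ + 3 * (α + β)` for indices, `δ / 2` for lower-order terms. A surplus `β` remains. -/
theorem exponent_le {α β δ lam n N h s : ℝ} (hs : s ≤ δ / 2 * (n * N))
    (hsmall : (3 + β) * n ≤ δ / 2 * (n * N)) (hh : h ≤ δ * N + 1) (hn : 0 ≤ n)
    (hlam : lam = 4 * δ + 4 * β + 3 * α) :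
    s + 2 * n * h + n + N * (δ * n + 3 * (α + β) * n) ≤ -β * n + lam * (n * N) - β * (n * N) := by
  have e1 : 2 * n * h ≤ 2 * n * (δ * N + 1) := by gcongr
  subst hlam
  linarith

theorem two_pow_mul_one_sub_pow_lt_one {n T : ℕ} {τ : ℝ} (hn : 1 ≤ n) (hτ : τ ≤ 1)
    (hT : (n : ℝ) ≤ τ * T) : 2 ^ n * (1 - τ) ^ T < 1 := by
  have hn' : (1 : ℝ) ≤ n := by exact_mod_cast hn
  calc 2 ^ n * (1 - τ) ^ T ≤ 2 ^ n * Real.exp (-τ) ^ T := by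
        have := Real.add_one_le_exp (-τ)
        have : 0 ≤ 1 - τ := by linarith
        gcongr
        linarith
    _ = Real.exp (n * Real.log 2 - τ * T) := by
        have e2 : (2 : ℝ) ^ n = Real.exp (n * Real.log 2) := by
          rw [Real.exp_nat_mul, Real.exp_log two_pos]
        rw [e2, ← Real.exp_nat_mul, ← Real.exp_add]
        congr 1; ring
    _ < 1 := by
        rw [Real.exp_lt_one_iff]
        nlinarith [Real.log_two_lt_d9]

/-- The factor `4` in `hK` charges the `4 ^ 2 ^ n` lost quotients to the index stored at each point.
-/
theorem code_size_le {n m ℓ T h L : ℕ} {a : ℝ} (hK : (T : ℝ) * (ℓ * L) * 4 ≤ 2 ^ a) :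
    (((m * (2 ^ m * 2)) * ((2 ^ n) ^ m * ((((2 ^ n) ^ m) ^ ℓ) ^ T *
        ((2 ^ n) ^ h * ((2 ^ n) ^ h * (T * (ℓ * L)) ^ 2 ^ n)))) * (2 ^ n * 4 ^ 2 ^ n) : ℕ) : ℝ) ≤
      2 ^ ((2 * (m : ℝ) + 1 + n * m + n * m * ℓ * T) + 2 * n * h + n + 2 ^ n * a) := by
  have hm2 : (m : ℝ) ≤ 2 ^ m := by exact_mod_cast Nat.lt_two_pow_self.le
  calc (((m * (2 ^ m * 2)) * ((2 ^ n) ^ m * ((((2 ^ n) ^ m) ^ ℓ) ^ T *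
        ((2 ^ n) ^ h * ((2 ^ n) ^ h * (T * (ℓ * L)) ^ 2 ^ n)))) * (2 ^ n * 4 ^ 2 ^ n) : ℕ) : ℝ)
      = m * (2 ^ m * 2 * (2 ^ n) ^ m * (((2 ^ n) ^ m) ^ ℓ) ^ T * ((2 ^ n) ^ h) ^ 2 * 2 ^ n *
          ((T : ℝ) * (ℓ * L) * 4) ^ 2 ^ n) := by push_cast; rw [mul_pow _ (4 : ℝ)]; ring
    _ ≤ 2 ^ m * (2 ^ m * 2 * (2 ^ n) ^ m * (((2 ^ n) ^ m) ^ ℓ) ^ T * ((2 ^ n) ^ h) ^ 2 * 2 ^ n *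
          (2 ^ a) ^ 2 ^ n) := by gcongr
    _ = 2 ^ ((2 * (m : ℝ) + 1 + n * m + n * m * ℓ * T) + 2 * n * h + n + 2 ^ n * a) := by
        have e1 : ((2 : ℝ) ^ a) ^ 2 ^ n = 2 ^ (2 ^ n * a) := by
          rw [← Real.rpow_natCast, ← Real.rpow_mul two_pos.le, mul_comm]; push_cast; rfl
        have e2 : (2 : ℝ) ^ m * (2 ^ m * 2 * (2 ^ n) ^ m * (((2 ^ n) ^ m) ^ ℓ) ^ T *
            ((2 ^ n) ^ h) ^ 2 * 2 ^ n) =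
            2 ^ ((2 * (m : ℝ) + 1 + n * m + n * m * ℓ * T) + 2 * n * h + n) := by
          have : (2 * (m : ℝ) + 1 + n * m + n * m * ℓ * T) + 2 * n * h + n =
              ((m + (m + 1 + n * m + n * m * ℓ * T + n * h * 2 + n) : ℕ) : ℝ) := by
            push_cast; ring
          rw [this, Real.rpow_natCast]
          simp only [← pow_mul, pow_add, pow_one]
        rw [e1, Real.rpow_add two_pos _ (2 ^ n * _), ← e2]; ring

end Estimates

/-! ### Choice of parameters and conclusion -/

section Main

open Classical in
theorem card_distinguish_le_rpow {lam α β : ℝ} (hlam : lam < 1) (hα : 0 < α) (hβ : 0 < β)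
    (hδ : 0 < (lam - 4 * β - 3 * α) / 4) {n m : ℕ} {ε C : ℝ} (hn : 1 ≤ n) (hm0 : 0 < m)
    (hC : 1 ≤ C) (hm : (m : ℝ) ≤ 2 ^ (α * n)) (hε : 2 ^ (-β * n) ≤ ε) (hε1 : ε ≤ 1)
    (hℓC : (numFactors lam α β m ε : ℝ) ≤ C * n)
    (h1 : 14 * C ^ 2 / ((lam - 4 * β - 3 * α) / 4) * (n : ℝ) ^ 3 ≤ 2 ^ ((1 - 2 * α - β) * n))
    (h2 : 2 * (3 + β) / ((lam - 4 * β - 3 * α) / 4) ≤ 2 ^ n)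
    (h3 : 24 * C ^ 2 * (n : ℝ) ^ 3 ≤ 2 ^ ((lam - 4 * β - 3 * α) / 4 * n)) (A : Set (Str m)) :
    (#{X | ε < |(#{y | extractor n (numFactors lam α β m ε) m X y ∈ A} : ℝ) /
        2 ^ (2 * (numFactors lam α β m ε * n)) - (#{v | v ∈ A} : ℝ) / 2 ^ m|} : ℝ) ≤
      ε * 2 ^ (lam * ((n : ℝ) * 2 ^ n)) := by
  have hpow := one_sub_pow_numFactors_le (β := β) hδ (by linarith) hm0
    (lt_of_lt_of_le (by positivity) hε) hε1
  set δ := (lam - 4 * β - 3 * α) / 4 with hδ'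
  set ℓ := numFactors lam α β m ε with hℓ
  have hn' : (1 : ℝ) ≤ n := by exact_mod_cast hn
  have hm1 : (1 : ℝ) ≤ m := by exact_mod_cast hm0
  have hε0 : 0 < ε := lt_of_lt_of_le (by positivity) hε
  set η := ε / m with hη
  have hη0 : 0 < η := by positivity
  have hη1 : η ≤ 1 := by rw [hη, div_le_one (by positivity)]; linarith
  -- With `ℓ = 0` the bound `hpow` would read `1 ≤ η / 8`.
  have hℓ0 : 0 < ℓ := by
    rcases Nat.eq_zero_or_pos ℓ with h0 | h0
    · rw [h0, pow_zero] at hpow; linarith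
    · exact h0
  have hℓ1 : (1 : ℝ) ≤ ℓ := by exact_mod_cast hℓ0
  set Q : ℝ := 2 ^ ((α + β) * n) with hQ
  have hQ1 : 1 ≤ Q := Real.one_le_rpow one_le_two (by positivity)
  have hηQ : 1 / η ≤ Q := by
    have : 1 / ε ≤ 2 ^ (β * n) := by
      rw [div_le_iff₀ hε0]
      calc (1 : ℝ) = 2 ^ (β * n) * 2 ^ (-β * n) := by
            rw [← Real.rpow_add two_pos]; simp
        _ ≤ 2 ^ (β * n) * ε := by gcongr
    calc 1 / η = m * (1 / ε) := by rw [hη]; field_simp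
      _ ≤ 2 ^ (α * n) * 2 ^ (β * n) := by gcongr
      _ = Q := by rw [hQ, ← Real.rpow_add two_pos]; congr 1; ring
  set N : ℝ := 2 ^ n with hN
  have hN0 : 0 < N := by positivity
  -- `h` bounds the exceptional points. `τ` makes `ℓ * τ = η / 2`, which with `η / 8` from `hpow`
  -- stays below `η`; `T` tuples then suffice since `exp (-n) < 2 ^ (-n)`; `L` is the list size.
  set h : ℕ := ⌈δ * N⌉₊ with hh
  set τ : ℝ := η / (2 * ℓ) with hτ
  set T : ℕ := ⌈n / τ⌉₊ with hT
  set L : ℕ := ⌈1 / η ^ 2⌉₊ with hL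
  have hτ0 : 0 < τ := by positivity
  have hτ1 : τ ≤ 1 := by rw [hτ, div_le_one (by positivity)]; linarith
  have hT0 : 0 < T := Nat.ceil_pos.mpr (by positivity)
  have hL0 : 0 < L := Nat.ceil_pos.mpr (by positivity)
  have hhN : (h : ℝ) ≤ N := by
    have : h ≤ 2 ^ n := Nat.ceil_le.mpr (by push_cast; rw [← hN]; nlinarith)
    rw [hN]; exact_mod_cast this
  have hcov : 2 ^ n * (1 - τ) ^ T < 1 := by
    refine two_pow_mul_one_sub_pow_lt_one hn hτ1 ?_
    calc (n : ℝ) = τ * (n / τ) := by field_simp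
      _ ≤ τ * T := by gcongr; exact Nat.le_ceil _
  have hdense : (N - h) ^ ℓ + ℓ * (τ * N ^ ℓ) < η * N ^ ℓ := by
    have e1 : (N - h) ^ ℓ ≤ η / 8 * N ^ ℓ := by
      calc (N - h) ^ ℓ ≤ ((1 - δ) * N) ^ ℓ := by
            refine pow_le_pow_left₀ (by linarith) ?_ _
            linarith [Nat.le_ceil (δ * N)]
        _ = (1 - δ) ^ ℓ * N ^ ℓ := mul_pow _ _ _
        _ ≤ η / 8 * N ^ ℓ := by gcongr
    have e2 : ℓ * (τ * N ^ ℓ) = η / 2 * N ^ ℓ := by rw [hτ]; field_simp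
    have e3 : 0 < η * N ^ ℓ := by positivity
    linarith
  have key := card_distinguish_le (h := h) hm0 hℓ0 hL0 hT0 τ ε hε0 hτ0.le hτ1 (Nat.le_ceil _)
    hdense hcov A
  have hTle : (T : ℝ) ≤ 3 * C * n ^ 2 * Q := by
    have e1 : n / τ ≤ 2 * C * n ^ 2 * Q := by
      calc n / τ = 2 * n * ℓ * (1 / η) := by rw [hτ]; field_simp
        _ ≤ 2 * n * (C * n) * Q := by gcongr
        _ = 2 * C * n ^ 2 * Q := by ring
    have e2 : 1 ≤ C * n ^ 2 * Q := by
      have : (1 : ℝ) ≤ n ^ 2 := one_le_pow₀ hn'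
      exact one_le_mul_of_one_le_of_one_le (one_le_mul_of_one_le_of_one_le hC this) hQ1
    linarith [Nat.ceil_lt_add_one (show 0 ≤ n / τ by positivity)]
  have hLle : (L : ℝ) ≤ 2 * Q ^ 2 := by
    have e1 : 1 / η ^ 2 ≤ Q ^ 2 := by
      rw [← one_div_pow]; gcongr
    have e2 : 1 ≤ Q ^ 2 := one_le_pow₀ hQ1
    linarith [Nat.ceil_lt_add_one (show 0 ≤ 1 / η ^ 2 by positivity)]
  have hindex : (T : ℝ) * (ℓ * L) * 4 ≤ 2 ^ (δ * n + 3 * (α + β) * n) := by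
    calc (T : ℝ) * (ℓ * L) * 4 ≤ 3 * C * n ^ 2 * Q * (C * n * (2 * Q ^ 2)) * 4 := by gcongr
      _ = 24 * C ^ 2 * n ^ 3 * Q ^ 3 := by ring
      _ ≤ 2 ^ (δ * n) * Q ^ 3 := by gcongr
      _ = 2 ^ (δ * n + 3 * (α + β) * n) := by
          rw [hQ, ← Real.rpow_natCast, ← Real.rpow_mul two_pos.le, ← Real.rpow_add two_pos]
          congr 1; push_cast; ring
  have horbits : 2 * (m : ℝ) + 1 + n * m + n * m * ℓ * T ≤ δ / 2 * (n * N) :=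
    orbit_bits_le hα hβ hδ hn' hm1 hC hm (by positivity) (by positivity) hℓC hTle h1
  have hsmall : (3 + β) * n ≤ δ / 2 * (n * N) := by
    have : (3 + β) ≤ δ / 2 * N := by
      calc 3 + β = δ / 2 * (2 * (3 + β) / δ) := by field_simp
        _ ≤ δ / 2 * N := by gcongr
    nlinarith
  have hhle : (h : ℝ) ≤ δ * N + 1 := (Nat.ceil_lt_add_one (by positivity)).le
  have hexp : (2 * (m : ℝ) + 1 + n * m + n * m * ℓ * T) + 2 * n * h + n +
      N * (δ * n + 3 * (α + β) * n) ≤ -β * n + lam * (n * N) := by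
    refine (exponent_le horbits hsmall hhle (by positivity) ?_).trans
      (sub_le_self _ (by positivity))
    rw [hδ']; ring
  refine (Nat.cast_le.mpr key).trans ((code_size_le hindex).trans ?_)
  calc _ ≤ (2 : ℝ) ^ (-β * n + lam * (n * N)) :=
        Real.rpow_le_rpow_of_exponent_le one_le_two hexp
    _ = 2 ^ (-β * n) * 2 ^ (lam * (n * N)) := Real.rpow_add two_pos _ _
    _ ≤ ε * 2 ^ (lam * (n * N)) := by gcongr

end Main

end CryptoExtractor

theorem mainTheorem1 (lam α β : ℝ) (hlam0 : 0 < lam) (hlam1 : lam < 1)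
    (hα0 : 0 < α) (hα1 : α < lam / 3) (hβ0 : 0 < β) (hβ1 : β < (lam - 3 * α) / 4) :
    ∃ (C : ℝ) (n₀ : ℕ), ∀ (n m : ℕ) (ε : ℝ), n₀ ≤ n →
      (m : ℝ) ≤ ((2 : ℝ) ^ n) ^ α → ((2 : ℝ) ^ n) ^ (-β) ≤ ε →
      CryptoExtractor.IsExtractor (lam * ((n : ℝ) * 2 ^ n)) (2 * ε)
          (CryptoExtractor.extractor n (CryptoExtractor.numFactors lam α β m ε) m) ∧
        (CryptoExtractor.numFactors lam α β m ε : ℝ) ≤ C * n ∧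
        ((2 * (CryptoExtractor.numFactors lam α β m ε * n) : ℕ) : ℝ) ≤
          C * Real.logb 2 ((n : ℝ) * 2 ^ n) ^ 2 := by
  classical
  have hδ : 0 < (lam - 4 * β - 3 * α) / 4 := by linarith
  set C := 3 / ((lam - 4 * β - 3 * α) / 4) * (1 + α + β) + 1 with hC
  have hC1 : 1 ≤ C := by
    have : 0 ≤ 3 / ((lam - 4 * β - 3 * α) / 4) * (1 + α + β) := by positivity
    linarith
  obtain ⟨n₀, h₀⟩ := Filter.eventually_atTop.mp
    ((CryptoExtractor.eventually_mul_pow_le (14 * C ^ 2 / ((lam - 4 * β - 3 * α) / 4))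
      (1 - 2 * α - β) (by linarith) 3).and
    ((CryptoExtractor.eventually_mul_pow_le (2 * (3 + β) / ((lam - 4 * β - 3 * α) / 4))
      1 one_pos 0).and
    (CryptoExtractor.eventually_mul_pow_le (24 * C ^ 2) _ hδ 3)))
  -- The seed consists of two halves of `ℓ * n ≤ C * n ^ 2` bits, hence `2 * C`.
  refine ⟨2 * C, max n₀ 1, fun n m ε hn hm hε => ?_⟩
  obtain ⟨h1, h2, h3⟩ := h₀ n ((le_max_left _ _).trans hn)
  have hn1 : 1 ≤ n := (le_max_right _ _).trans hn
  have hn1' : (1 : ℝ) ≤ n := by exact_mod_cast hn1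
  rw [CryptoExtractor.rpow_two_natCast_mul] at hm hε
  have hε0 : 0 < ε := lt_of_lt_of_le (by positivity) hε
  have hℓ := CryptoExtractor.numFactors_le hδ hα0 hβ0 hn1 hm hε
  rw [← hC] at hℓ
  refine ⟨?_, by nlinarith, ?_⟩
  · refine CryptoExtractor.isExtractor_of_card_le _ fun A => ?_
    rcases Nat.eq_zero_or_pos m with rfl | hm0
    -- For `m = 0` there is a single output string, so no input fails any test.
    · convert (by positivity : (0 : ℝ) ≤ ε * 2 ^ (lam * ((n : ℝ) * 2 ^ n))) using 1
      rw [Nat.cast_eq_zero, Finset.card_eq_zero, Finset.filter_eq_empty_iff]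
      intro X _
      rcases Set.eq_empty_or_nonempty A with rfl | hA
      · simpa using hε0.le
      · have hA' : ∀ v, v ∈ A := fun v => by
          obtain ⟨w, hw⟩ := hA
          rwa [Subsingleton.elim v w]
        simpa [hA'] using hε0.le
    · rcases le_or_gt ε 1 with hε1 | hε1
      · convert CryptoExtractor.card_distinguish_le_rpow hlam1 hα0 hβ0 hδ hn1 hm0 hC1 hm hε hε1 hℓ
          h1 (by simpa using h2) h3 A
      -- For `ε > 1` no input fails, since probabilities differ by at most `1`.
      · convert (by positivity : (0 : ℝ) ≤ ε * 2 ^ (lam * ((n : ℝ) * 2 ^ n))) using 1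
        rw [Nat.cast_eq_zero, Finset.card_eq_zero, Finset.filter_eq_empty_iff]
        intro X _
        exact not_lt.mpr ((CryptoExtractor.abs_card_div_sub_card_div_le_one _ _).trans hε1.le)
  · have hlog : (n : ℝ) ≤ Real.logb 2 ((n : ℝ) * 2 ^ n) := by
      rw [Real.le_logb_iff_rpow_le one_lt_two (by positivity), Real.rpow_natCast]
      exact le_mul_of_one_le_left (by positivity) hn1'
    push_cast
    calc 2 * ((CryptoExtractor.numFactors lam α β m ε : ℝ) * n) ≤ 2 * (C * n * n) := by gcongr
      _ = 2 * C * n ^ 2 := by ring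
      _ ≤ 2 * C * Real.logb 2 ((n : ℝ) * 2 ^ n) ^ 2 := by gcongr
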